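/- Let $K$ be a commutative $\mathbb{Q}$-algebra, $A$ a finite set, $\mathbf s=(s_a)_{a\in A}$ a family of elements of $K$, and $(c_{n,a,k})_{n\ge 0,\,a\in A,\,k\ge 1}$ a family of elements of $K$. Put $F_{a,k}(\rho)=\sum_{n\ge 0}c_{n,a,k}\,\rho^{n-1}$. Consider, for series $G_a(x,L)\in K[L][[x]]$ $(a\in A)$ with constant term $1$ in $x$, the system $$G_a(x,L)=1+\sum_{k\ge 1}x^k\,G_a(x,\partial_\rho)\,Q(x,\partial_\rho)^k\,(e^{L\rho}-1)F_{a,k}(\rho)\Big|_{\rho=0},\qquad Q(x,L)=\prod_{a\in A}G_a(x,L)^{s_a},$$ where, for $H\in K[L][[x]]$, the operator $H(x,\partial_\rho)$ is obtained by replacing $L$ by $\partial_\rho$ in each coefficient of $H$ in $x$, and $f^{p}=\sum_{r\ge 0}\frac{(p)_r}{r!}(f-1)^r$ with $(p)_r=p(p-1)\cdots(p-r+1)$. *Notation.* Trees are finite rooted trees whose vertices $v$ are decorated by pairs $d(v)=(\alpha(v),w(v))\in A\times\mathbb{Z}_{\ge 1}$ (type and weight), taken up to isomorphism, that is, graph isomorphism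 preserving the root and the decorations; $\operatorname{Aut}(t)$ is the automorphism group of $t$, $\operatorname{rt}(t)$ its root, $V(t)$ its vertex set, and $w(t)=\sum_{v\in V(t)}w(v)$. Let $\mathrm{od}_a(v)$ be the number of children of $v$ of type $a$, and $$\xi(v,\mathbf s)=(1+s_{\alpha(v)}w(v))_{\mathrm{od}_{\alpha(v)}(v)}\prod_{a\ne\alpha(v)}(s_a w(v))_{\mathrm{od}_a(v)} .$$ A tube of $t$ is a nonempty set of vertices inducing a connected subgraph. A binary tubing $\tau$ of $t$ is a set of tubes, any two of which are nested or disjoint, which contains $V(t)$ and in which each tube either is a single vertex or is partitioned by two other tubes of $\tau$; $\mathrm{Tub}(t)$ is the set of binary tubings of $t$. The root of a tube is its vertex closest to $\operatorname{rt}(t)$; $b(v,\tau)$ is the number of tubes of $\tau$ with root $v$, and $b(\tau)=b(\operatorname{rt}(t),\tau)$. Finally $c(\tau)=\prod_{v\ne\operatorname{rt}(t)}c_{b(v,\tau)-1,\,\alpha(v),\,w(v)}$. **Theorem.** The system has exactly one solution $(G_a)_{a\in A}$. It is given by $$G_a(x,L)=1+\sum_{t:\ \alpha(\operatorname{rt}(t))=a}\Big(\prod_{v\in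 V(t)}\xi(v,\mathbf s)\Big)\Big(\sum_{\tau\in\mathrm{Tub}(t)}c(\tau)\sum_{i=1}^{b(\tau)}c_{b(\tau)-i,\,a,\,w(\operatorname{rt}(t))}\frac{L^i}{i!}\Big)\frac{x^{w(t)}}{|\operatorname{Aut}(t)|},$$ where for each $n$ only finitely many trees contribute to the coefficient of $x^n$. -/

import Mathlib

noncomputable section

namespace DysonSchwinger

open Finset

/-! ### Decorated rooted trees -/

/-- A rooted tree with vertex set `V`, decorated by elements of `D`. Every vertex other than the
root has a parent, and iterating `parent` from any vertex leads to the root.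
By convention the root is its own `parent`. -/
structure DecTree (D V : Type*) where
  root : V
  parent : V → V
  parent_root : parent root = root
  reaches_root : ∀ v, ∃ n : ℕ, parent^[n] v = root
  dec : V → D

namespace DecTree

variable {D V W : Type*}

/-- The underlying graph: edges join each non-root vertex to its parent. -/
def graph (t : DecTree D V) : SimpleGraph V :=
  SimpleGraph.fromRel fun u v => t.parent u = v

/-- `u` is a child of `v`. -/
def IsChild (t : DecTree D V) (u v : V) : Prop :=
  u ≠ t.root ∧ t.parent u = v

/-- Isomorphisms of decorated rooted trees: graph isomorphisms which preserve the root and the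
decorations of all vertices. -/
def Iso (t : DecTree D V) (t' : DecTree D W) : Type _ :=
  {f : t.graph ≃g t'.graph // f t.root = t'.root ∧ ∀ v, t'.dec (f v) = t.dec v}

/-- The automorphisms of a decorated rooted tree. -/
abbrev Aut (t : DecTree D V) : Type _ := Iso t t

/-! ### Tubes and binary tubings -/

/-- A tube is a (nonempty) set of vertices which induces a connected subgraph. -/
def IsTube (t : DecTree D V) (b : Finset V) : Prop :=
  (t.graph.induce (b : Set V)).Connected

/-- `v` is the root of the tube `b`: it lies in `b`, and every vertex of `b` is `v` or a
descendant of `v`. -/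
def IsTubeRoot (t : DecTree D V) (v : V) (b : Finset V) : Prop :=
  v ∈ b ∧ ∀ u ∈ b, ∃ n : ℕ, t.parent^[n] u = v

/-- A binary tubing: a nested family of tubes containing the tube of all vertices, in which every
tube that is not a single vertex is partitioned by two other tubes of the family. -/
structure IsTubing [Fintype V] [DecidableEq V] (t : DecTree D V) (τ : Finset (Finset V)) :
    Prop where
  isTube : ∀ b ∈ τ, t.IsTube b
  univ_mem : Finset.univ ∈ τ
  nested : ∀ b ∈ τ, ∀ b' ∈ τ, b ⊆ b' ∨ b' ⊆ b ∨ Disjoint b b'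
  partition : ∀ b ∈ τ, b.card = 1 ∨ ∃ b₁ ∈ τ, ∃ b₂ ∈ τ, Disjoint b₁ b₂ ∧ b₁ ∪ b₂ = b

open scoped Classical in
/-- `Tub(t)`, the set of all binary tubings of `t`. -/
def tubings [Fintype V] [DecidableEq V] (t : DecTree D V) : Finset (Finset (Finset V)) :=
  Finset.univ.filter fun τ => t.IsTubing τ

open scoped Classical in
/-- The statistic `b(v, τ)`: the number of tubes of `τ` whose root is `v`. -/
def bStat (t : DecTree D V) (v : V) (τ : Finset (Finset V)) : ℕ :=
  (τ.filter fun b => t.IsTubeRoot v b).card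

/-- The statistic `b(τ) = b(rt(t), τ)`. -/
def bRoot (t : DecTree D V) (τ : Finset (Finset V)) : ℕ := t.bStat t.root τ

/-- The Mellin monomial `c(τ)`, the product of `c_{b(v, τ) - 1, d(v)}` over the non-root
vertices `v`. -/
def mellin {K : Type*} [CommRing K] [Fintype V] [DecidableEq V] (t : DecTree D V)
    (c : ℕ → D → K) (τ : Finset (Finset V)) : K :=
  ∏ v ∈ Finset.univ.erase t.root, c (t.bStat v τ - 1) (t.dec v)

end DecTree

/-! ### Isomorphism classes of finite decorated rooted trees -/

/-- Finite decorated rooted trees, with vertex set `{0, …, n - 1}` for some `n`. -/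
abbrev FinTree (D : Type*) : Type _ := Σ n : ℕ, DecTree D (Fin n)

/-- Two finite decorated rooted trees are identified when they are isomorphic. -/
instance finTreeSetoid (D : Type*) : Setoid (FinTree D) where
  r t t' := Nonempty (DecTree.Iso t.2 t'.2)
  iseqv :=
    { refl := fun t => ⟨⟨SimpleGraph.Iso.refl, rfl, fun _ => rfl⟩⟩
      symm := by
        rintro t t' ⟨f, h₁, h₂⟩
        refine ⟨⟨f.symm, ?_, fun v => ?_⟩⟩
        · rw [← h₁]; exact f.symm_apply_apply _
        · rw [← h₂]; exact congrArg _ (f.apply_symm_apply v)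
      trans := by
        rintro t t' t'' ⟨f, h₁, h₂⟩ ⟨g, k₁, k₂⟩
        refine ⟨⟨f.trans g, ?_, fun v => ?_⟩⟩
        · change g (f _) = _
          rw [h₁, k₁]
        · change t''.2.dec (g (f _)) = _
          rw [k₂, h₂] }

/-- Decorated rooted trees up to isomorphism. -/
def TreeClass (D : Type*) : Type _ := Quotient (finTreeSetoid D)

/-- The number of vertices of (a representative of) a tree. -/
def TreeClass.size {D : Type*} (t : TreeClass D) : ℕ := (Quotient.out t).1

/-- A representative of an isomorphism class of trees. -/
def TreeClass.rep {D : Type*} (t : TreeClass D) : DecTree D (Fin t.size) := (Quotient.out t).2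

/-! ### Types and weights -/

section Types

variable {A : Type*}

/-- The type `α(v)` of a vertex of an `A × ℤ_{≥ 1}`-decorated tree. -/
def vtype {V : Type*} (t : DecTree (A × ℕ+) V) (v : V) : A := (t.dec v).1

/-- The weight `w(v)` of a vertex of an `A × ℤ_{≥ 1}`-decorated tree. -/
def vweight {V : Type*} (t : DecTree (A × ℕ+) V) (v : V) : ℕ+ := (t.dec v).2

/-- The weight `w(t)` of a tree, the sum of the weights of its vertices. -/
def weight {V : Type*} [Fintype V] (t : DecTree (A × ℕ+) V) : ℕ := ∑ v, (vweight t v : ℕ)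

/-- The number `od_a(v)` of children of type `a` of the vertex `v`. -/
def od {V : Type*} (t : DecTree (A × ℕ+) V) (a : A) (v : V) : ℕ :=
  Nat.card {u : V // t.IsChild u v ∧ vtype t u = a}

/-- Isomorphism classes of `A × ℤ_{≥ 1}`-decorated rooted trees with root of type `a`. -/
def TreesOfType (a : A) : Type _ :=
  {t : TreeClass (A × ℕ+) // vtype t.rep t.rep.root = a}

end Types

/-! ### Formal power series -/

open Polynomial in
/-- The falling factorial `(p)_n = p (p - 1) ⋯ (p - n + 1)`. -/
def fallingFactorial {K : Type*} [CommRing K] (p : K) (n : ℕ) : K :=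
  (descPochhammer K n).eval p

/-- A family of power series is locally finite if for each `n` only finitely many of its members
have a nonzero coefficient of `x ^ n`. -/
def LocallyFinite {ι R : Type*} [CommRing R] (f : ι → PowerSeries R) : Prop :=
  ∀ n : ℕ, {i | PowerSeries.coeff n (f i) ≠ 0}.Finite

/-- The sum of a locally finite family of power series, taken coefficientwise. -/
def formalSum {ι R : Type*} [CommRing R] (f : ι → PowerSeries R) : PowerSeries R :=
  PowerSeries.mk fun n => ∑ᶠ i, PowerSeries.coeff n (f i)

/-- The sum over `k` in the system below is locally finite. -/
theorem locallyFinite_X_pow_mul {R : Type*} [CommRing R] (H : ℕ+ → PowerSeries R) :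
    LocallyFinite fun k : ℕ+ => PowerSeries.X ^ (k : ℕ) * H k := by
  intro n
  refine (Set.finite_Iic (⟨n + 1, n.succ_pos⟩ : ℕ+)).subset fun (k : ℕ+) hk => ?_
  by_contra hlt
  have h : n + 1 < (k : ℕ) := PNat.coe_lt_coe _ _ |>.mpr (not_le.mp hlt)
  have h' : ¬ (k : ℕ) ≤ n := by omega
  exact hk (by rw [PowerSeries.coeff_X_pow_mul', if_neg h'])

open Polynomial

section Series

variable {K : Type*} [CommRing K] [Algebra ℚ K]

/-- The binomial series `(1 + u) ^ p = ∑ (p)_r / r! u ^ r`. -/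
def binSeries (p : K) : PowerSeries K :=
  PowerSeries.mk fun r => algebraMap ℚ K (1 / (r.factorial : ℚ)) * fallingFactorial p r

/-- The power `f ^ p` with exponent `p` in `K` of a power series `f` over `K[L]` with constant
term `1`, obtained by substituting `u = f - 1` in the binomial series `(1 + u) ^ p`. -/
def spow (f : PowerSeries K[X]) (p : K) : PowerSeries K[X] :=
  PowerSeries.subst (f - 1) (binSeries p)

/-- The exponential `e ^ {Lρ}`, as a series in `ρ` over `K[L]`. -/
def expL (K : Type*) [CommRing K] [Algebra ℚ K] : PowerSeries K[X] :=
  PowerSeries.rescale (X : K[X]) (PowerSeries.exp K[X])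

/-- The Laurent series `F(ρ) = ∑_{n ≥ 0} c_n ρ ^ (n - 1)`, regarded as a series over `K[L]`. -/
def laurentF (c : ℕ → K) : LaurentSeries K[X] :=
  HahnSeries.single (-1 : ℤ) (1 : K[X]) *
    HahnSeries.ofPowerSeries ℤ K[X] (PowerSeries.mk fun n => C (c n))

/-- The differential operator `p(∂_ρ)` for a polynomial `p` with coefficients in `K`, acting on
Laurent series in `ρ` over `K[L]`. -/
def diffOp (p : K[X]) : Module.End K (LaurentSeries K[X]) :=
  aeval (LaurentSeries.derivative K : Module.End K (LaurentSeries K[X])) p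

/-- `Λ p = p(∂_ρ) (e ^ {Lρ} - 1) F(ρ) |_{ρ = 0}`, for `F(ρ) = ∑_{n ≥ 0} c_n ρ ^ (n - 1)`. The
series `(e ^ {Lρ} - 1) F(ρ)` has no negative powers of `ρ`, so that setting `ρ = 0` means taking
the coefficient of `ρ ^ 0`. -/
def Lam (c : ℕ → K) (p : K[X]) : K[X] :=
  (diffOp p (HahnSeries.ofPowerSeries ℤ K[X] (expL K - 1) * laurentF c)).coeff 0

/-- The operator `Λ` applied to each coefficient of a power series in `x` over `K[L]`: for
`H(x, L)` this is `H(x, ∂_ρ) (e ^ {Lρ} - 1) F(ρ) |_{ρ = 0}`. -/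
def LamSeries (c : ℕ → K) (H : PowerSeries K[X]) : PowerSeries K[X] :=
  PowerSeries.mk fun n => Lam c (PowerSeries.coeff n H)

end Series

/-! ### The system and its tubing expansion -/

section System

variable {K : Type*} [CommRing K] [Algebra ℚ K] {A : Type*} [Fintype A]

/-- `Q = ∏_a G_a ^ {s_a}`. -/
def Qser (s : A → K) (G : A → PowerSeries K[X]) : PowerSeries K[X] :=
  ∏ a, spow (G a) (s a)

/-- `G` solves the system
`G_a(x, L) = 1 + ∑_{k ≥ 1} x ^ k G_a(x, ∂_ρ) Q(x, ∂_ρ) ^ k (e ^ {Lρ} - 1) F_{a,k}(ρ) |_{ρ = 0}`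
with `Q = ∏_a G_a ^ {s_a}` and `F_{a,k}(ρ) = ∑_{n ≥ 0} c_{n,a,k} ρ ^ (n - 1)`. The series `G_a`
have constant term `1`, as is needed for the powers `G_a ^ {s_a}` to make sense. -/
structure IsSolution (s : A → K) (c : ℕ → A × ℕ+ → K) (G : A → PowerSeries K[X]) : Prop where
  constantCoeff_eq_one : ∀ a, PowerSeries.constantCoeff (G a) = 1
  equation : ∀ a, G a = 1 + formalSum fun k : ℕ+ =>
    PowerSeries.X ^ (k : ℕ) * LamSeries (fun n => c n (a, k)) (G a * Qser s G ^ (k : ℕ))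

/-- `ξ(v, s) = (1 + s_{α(v)} w(v))_{od_{α(v)}(v)} ∏_{a ≠ α(v)} (s_a w(v))_{od_a(v)}`. -/
def xi {V : Type*} [DecidableEq A] (s : A → K) (t : DecTree (A × ℕ+) V) (v : V) : K :=
  fallingFactorial (1 + s (vtype t v) * ((vweight t v : ℕ) : K)) (od t (vtype t v) v) *
    ∏ a ∈ Finset.univ.erase (vtype t v),
      fallingFactorial (s a * ((vweight t v : ℕ) : K)) (od t a v)

/-- The polynomial `∑_{τ ∈ Tub(t)} c(τ) ∑_{i=1}^{b(τ)} c_{b(τ) - i, d(rt(t))} L ^ i / i!`. -/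
def tubingSum {V : Type*} [Fintype V] [DecidableEq V] (c : ℕ → A × ℕ+ → K)
    (t : DecTree (A × ℕ+) V) : K[X] :=
  ∑ τ ∈ t.tubings, C (t.mellin c τ) *
    ∑ i ∈ Finset.Icc 1 (t.bRoot τ),
      C (c (t.bRoot τ - i) (t.dec t.root) * algebraMap ℚ K (1 / (i.factorial : ℚ))) * X ^ i

/-- The contribution of a tree `t` to the expansion: the polynomial `tubingSum c t`, times
`(∏_v ξ(v, s)) x ^ {w(t)} / |Aut(t)|`. -/
def treeTerm {V : Type*} [Fintype V] [DecidableEq V] [DecidableEq A] (s : A → K)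
    (c : ℕ → A × ℕ+ → K) (t : DecTree (A × ℕ+) V) : PowerSeries K[X] :=
  PowerSeries.monomial (weight t)
    (C ((∏ v, xi s t v) * algebraMap ℚ K (1 / (Nat.card t.Aut : ℚ))) * tubingSum c t)

/-- The contributions of all the trees with root of type `a`. -/
def treeTerms [DecidableEq A] (s : A → K) (c : ℕ → A × ℕ+ → K) (a : A) :
    TreesOfType a → PowerSeries K[X] :=
  fun t => treeTerm s c t.1.rep

/-- The tubing expansion: `1` plus the sum of the contributions of all trees with root of
type `a`. -/
def tubingExpansion [DecidableEq A] (s : A → K) (c : ℕ → A × ℕ+ → K) (a : A) :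
    PowerSeries K[X] :=
  1 + formalSum (treeTerms s c a)

end System

end DysonSchwinger

end

/-! Write Λ for the operator p ↦ p(∂_ρ)(e^{Lρ} - 1)F(ρ)|_{ρ=0}. In degree n the system expresses a
coefficient of `G a` through Λ applied to coefficients of G_a Q^k of degree n - k < n, so there is
at most one solution (`IsSolution.unique`). For existence, the tubing expansion is shown to obey the
same recursion, with plane trees as the intermediary.

Tubing side: the tubing sum of a tree is Λ of the product of the tubing sums of the branches at its
root (`DecTree.subtreeSum_eq`). A binary tubing of a tube with at least two vertices is a choice of
an edge to cut together with tubings of the two parts (`sum_tubingsOf`), and the upper part has one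
tube fewer at the root. Hence differentiating ∑ c(τ) L^{b-1}/(b-1)! produces a sum over cuts. Since
(Λp)' = (Λp)_1 + Λ(p') (`derivative_Lam`), the Leibniz rule gives the product over the children the
same derivative; constant terms agree as well (`rootSum_eq_prod`).

Series side: G_a Q^k is a product of powers of the G_b whose exponents are the parameters occurring
in ξ (`mul_Qser_pow`). Its expansion runs over words of m trees, with coefficient 1/m! times falling
factorials (`coeff_prod_spow`). Iteration yields plane trees weighted by ∏ 1/m!. Over all plane
embeddings of one tree these weights add up to 1/|Aut| (`PlaneTree.sum_mass`), which turns the sum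
over plane trees into the sum over isomorphism classes. -/

noncomputable section

namespace DysonSchwinger

open Finset Polynomial

/-! ### The operator Λ on divided powers. -/

section Lambda

variable {K : Type*} [CommRing K] [Algebra ℚ K]

/-- The inverse factorial `1 / n!` in a `ℚ`-algebra. -/
def invFac (K : Type*) [CommRing K] [Algebra ℚ K] (n : ℕ) : K :=
  algebraMap ℚ K (1 / (n.factorial : ℚ))

theorem factorial_mul_invFac (n : ℕ) : (n.factorial : K) * invFac K n = 1 := by
  rw [invFac, ← map_natCast (algebraMap ℚ K), ← map_mul, mul_one_div_cancel, map_one]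
  exact_mod_cast n.factorial_ne_zero

theorem invFac_zero : invFac K 0 = 1 := by simp [invFac]

theorem invFac_one : invFac K 1 = 1 := by simp [invFac]

theorem succ_mul_invFac_succ (n : ℕ) : ((n : K) + 1) * invFac K (n + 1) = invFac K n := by
  have h := factorial_mul_invFac (K := K) (n + 1)
  have h' := factorial_mul_invFac (K := K) n
  rw [Nat.factorial_succ] at h
  push_cast at h
  linear_combination (invFac K n) * h - (n + 1) * invFac K (n + 1) * h'

/-- The operator `Λ` as a linear map. -/
def lamLin (c : ℕ → K) : K[X] →ₗ[K] K[X] where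
  toFun := Lam c
  map_add' p q := by simp [Lam, diffOp]
  map_smul' a p := by simp [Lam, diffOp]

theorem lamLin_apply (c : ℕ → K) (p : K[X]) : lamLin c p = Lam c p := rfl

theorem coeff_expL (n : ℕ) : PowerSeries.coeff n (expL K) = C (invFac K n) * X ^ n := by
  rw [expL, PowerSeries.coeff_rescale, PowerSeries.coeff_exp, mul_comm, invFac]
  rfl

/-- Applying ∂_ρ^m and setting ρ = 0 extracts m! times the coefficient of ρ^m. The factor e^{Lρ} - 1
has no constant term, which cancels the pole of F and shifts the exponent of L to j + 1. -/
theorem Lam_X_pow (c : ℕ → K) (m : ℕ) :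
    Lam c (X ^ m) = ∑ j ∈ range (m + 1),
      C ((m.factorial : K) * c (m - j) * invFac K (j + 1)) * X ^ (j + 1) := by
  have h1 : ∀ f : LaurentSeries K[X], (diffOp (X ^ m : K[X]) f).coeff 0 =
      m.factorial • f.coeff m := by
    intro f
    rw [diffOp, map_pow, aeval_X, Module.End.pow_apply, LaurentSeries.derivative_iterate,
      HahnSeries.coeff_nsmul, Pi.smul_apply, LaurentSeries.hasseDeriv_coeff, zero_add,
      Ring.choose_natCast, Nat.choose_self, Nat.cast_one, one_smul]
  have h2 : ((m : ℤ) - -1) = ((m + 1 : ℕ) : ℤ) := by push_cast; ring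
  rw [Lam, h1, laurentF, mul_left_comm, ← map_mul, HahnSeries.coeff_single_mul, h2, one_mul,
    HahnSeries.ofPowerSeries_apply_coeff, PowerSeries.coeff_mul,
    Finset.Nat.sum_antidiagonal_eq_sum_range_succ_mk, sum_range_succ', smul_add, Finset.smul_sum]
  simp only [map_sub, coeff_expL, PowerSeries.coeff_mk, invFac_zero]
  simp only [PowerSeries.coeff_one]
  simp only [map_one, pow_zero, mul_one, Nat.succ_ne_zero, if_false, sub_zero, if_true, sub_self,
    zero_mul, smul_zero, add_zero, Nat.add_sub_add_right]
  refine sum_congr rfl fun j _ => ?_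
  rw [nsmul_eq_mul, C_mul, C_mul, C_eq_natCast]
  ring

theorem Lam_divided_pow (c : ℕ → K) (m : ℕ) :
    Lam c (C (invFac K m) * X ^ m) = ∑ j ∈ range (m + 1),
      C (c (m - j) * invFac K (j + 1)) * X ^ (j + 1) := by
  rw [← smul_eq_C_mul, ← lamLin_apply, map_smul, lamLin_apply, Lam_X_pow, Finset.smul_sum]
  refine sum_congr rfl fun j _ => ?_
  rw [smul_eq_C_mul, ← mul_assoc, ← C_mul]
  congr 2
  linear_combination (c (m - j) * invFac K (j + 1)) * factorial_mul_invFac (K := K) m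

theorem derivative_divided_pow (m : ℕ) :
    derivative (C (invFac K (m + 1)) * X ^ (m + 1)) = C (invFac K m) * X ^ m := by
  rw [derivative_C_mul_X_pow, Nat.add_sub_cancel, ← succ_mul_invFac_succ m, mul_comm (invFac K _)]
  push_cast
  rfl

theorem coeff_zero_Lam (c : ℕ → K) (p : K[X]) : (Lam c p).coeff 0 = 0 := by
  have : (lcoeff K 0) ∘ₗ lamLin c = 0 := by
    ext m
    simp [lamLin_apply, Lam_X_pow, ← C_mul_X_pow_eq_monomial]
  exact LinearMap.congr_fun this p

theorem coeff_one_Lam_divided_pow (c : ℕ → K) (m : ℕ) :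
    (Lam c (C (invFac K m) * X ^ m)).coeff 1 = c m := by
  rw [Lam_divided_pow, finsetSum_coeff, sum_range_succ']
  simp only [coeff_C_mul_X_pow]
  simp [invFac_one]

/-- On L^m/m! the image is ∑ c_{m-j} L^{j+1}/(j+1)!. Differentiation lowers every exponent by one,
which is the effect of lowering m, except for the term j = 0, whose derivative is the constant c_m.
-/
theorem derivative_Lam (c : ℕ → K) (p : K[X]) :
    derivative (Lam c p) = C ((Lam c p).coeff 1) + Lam c (derivative p) := by
  -- Both sides are linear in `p`, and divided powers span K[X] because factorials are invertible.
  suffices h : ∀ m, derivative (Lam c (C (invFac K m) * X ^ m)) =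
      C ((Lam c (C (invFac K m) * X ^ m)).coeff 1) +
        Lam c (derivative (C (invFac K m) * X ^ m)) by
    have key : (derivative : K[X] →ₗ[K] K[X]) ∘ₗ lamLin c =
        (Algebra.linearMap K K[X] ∘ₗ lcoeff K 1 ∘ₗ lamLin c) + lamLin c ∘ₗ derivative := by
      refine Polynomial.lhom_ext' fun m => LinearMap.ext_ring ?_
      have hm : (monomial m (1 : K)) = (m.factorial : K) • (C (invFac K m) * X ^ m) := by
        rw [smul_eq_C_mul, ← mul_assoc, ← C_mul, factorial_mul_invFac, C_mul_X_pow_eq_monomial]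
      rw [LinearMap.comp_apply _ (monomial m), LinearMap.comp_apply _ (monomial m), hm, map_smul, map_smul]
      congr 1
      exact h m
    exact LinearMap.congr_fun key p
  intro m
  rw [coeff_one_Lam_divided_pow]
  cases m with
  | zero =>
    rw [Lam_divided_pow]
    simp [invFac_zero, invFac_one, ← lamLin_apply]
  | succ m =>
    rw [derivative_divided_pow, Lam_divided_pow, Lam_divided_pow, derivative_sum, sum_range_succ',
      add_comm]
    congr 1
    · simp [invFac_one]
    · refine sum_congr rfl fun j _ => ?_
      rw [C_mul, mul_assoc, derivative_C_mul, derivative_divided_pow, C_mul, mul_assoc,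
        Nat.add_sub_add_right]

theorem eq_of_derivative_eq_of_coeff_zero_eq {p q : K[X]} (h : derivative p = derivative q)
    (h0 : p.coeff 0 = q.coeff 0) : p = q := by
  ext n
  cases n with
  | zero => exact h0
  | succ n =>
    have h1 := congrArg (fun r => coeff r n * (invFac K (n + 1) * (n.factorial : K))) h
    simp only [coeff_derivative] at h1
    have h2 := factorial_mul_invFac (K := K) (n + 1)
    rw [Nat.factorial_succ] at h2
    push_cast at h2
    linear_combination h1 - (p.coeff (n + 1) - q.coeff (n + 1)) * h2

end Lambda

/-! ### Powers with exponents in K, and agreement of series up to a given order. -/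

section BinomialPowers

variable {K : Type*} [CommRing K] [Algebra ℚ K]

omit [Algebra ℚ K] in
theorem fallingFactorial_eq_smeval (p : K) (n : ℕ) :
    fallingFactorial p n = (descPochhammer ℤ n).smeval p := by
  rw [fallingFactorial, ← descPochhammer_map (algebraMap ℤ K), Polynomial.eval_map_algebraMap,
    Polynomial.aeval_eq_smeval]

/-- The binomial coefficient `(p)_r / r!`. -/
def binCoeff (p : K) (r : ℕ) : K := invFac K r * fallingFactorial p r

theorem coeff_binSeries (p : K) (r : ℕ) : PowerSeries.coeff r (binSeries p) = binCoeff p r := by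
  simp [binSeries, binCoeff, invFac]

theorem invFac_mul_choose {i j n : ℕ} (h : i + j = n) :
    invFac K n * (n.choose i : K) = invFac K i * invFac K j := by
  have h1 := factorial_mul_invFac (K := K) n
  have h2 := factorial_mul_invFac (K := K) i
  have h3 := factorial_mul_invFac (K := K) j
  subst h
  have h4 := Nat.choose_mul_factorial_mul_factorial (Nat.le_add_right i j)
  rw [Nat.add_sub_cancel_left] at h4
  have h5 : ((i + j).choose i : K) * (i.factorial : K) * (j.factorial : K) =
      ((i + j).factorial : K) := by
    rw [← h4]; push_cast; ring
  linear_combination (-(invFac K (i+j) * ((i + j).choose i : K)) * h2) -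
    (invFac K (i+j) * ((i + j).choose i : K)) * (i.factorial : K) * invFac K i * h3 +
    invFac K (i+j) * invFac K i * invFac K j * h5 + invFac K i * invFac K j * h1

/-- This is the Vandermonde identity for falling factorials, divided by n!. -/
theorem binSeries_add (p q : K) : binSeries (p + q) = binSeries p * binSeries q := by
  ext n
  rw [PowerSeries.coeff_mul, coeff_binSeries, binCoeff, fallingFactorial_eq_smeval,
    Ring.descPochhammer_smeval_add n (Commute.all p q), mul_sum]
  refine sum_congr rfl fun ij hij => ?_
  rw [coeff_binSeries, coeff_binSeries, binCoeff, binCoeff, ← fallingFactorial_eq_smeval,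
    ← fallingFactorial_eq_smeval, ← mul_assoc, invFac_mul_choose (mem_antidiagonal.mp hij)]
  ring

theorem binSeries_zero : binSeries (0 : K) = 1 := by
  ext n
  rw [coeff_binSeries, PowerSeries.coeff_one, binCoeff, fallingFactorial]
  rcases n with _ | n
  · simp [invFac_zero]
  · simp [descPochhammer_succ_left]

theorem binSeries_one : binSeries (1 : K) = 1 + PowerSeries.X := by
  ext n
  rw [coeff_binSeries, map_add, PowerSeries.coeff_one, PowerSeries.coeff_X, binCoeff,
    fallingFactorial]
  rcases n with _ | _ | n
  · simp [invFac_zero]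
  · simp [invFac_one]
  · simp [descPochhammer_succ_left]

theorem binSeries_natCast_mul (p : K) (k : ℕ) : binSeries (p * k) = binSeries p ^ k := by
  induction k with
  | zero => simp [binSeries_zero]
  | succ k ih => rw [Nat.cast_succ, mul_add, mul_one, binSeries_add, ih, pow_succ]

variable {f : PowerSeries K[X]}

omit [Algebra ℚ K] in
theorem hasSubst_sub_one (hf : PowerSeries.constantCoeff f = 1) :
    PowerSeries.HasSubst (f - 1) :=
  PowerSeries.HasSubst.of_constantCoeff_zero' (by simp [hf])

theorem spow_add (hf : PowerSeries.constantCoeff f = 1) (p q : K) :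
    spow f (p + q) = spow f p * spow f q := by
  rw [spow, binSeries_add, PowerSeries.subst_mul (hasSubst_sub_one hf)]; rfl

theorem spow_one (hf : PowerSeries.constantCoeff f = 1) : spow f (1 : K) = f := by
  have h := hasSubst_sub_one hf
  rw [spow, binSeries_one, PowerSeries.subst_add h, PowerSeries.subst_X h,
    ← PowerSeries.coe_substAlgHom h, map_one]
  exact add_sub_cancel _ _

theorem spow_mul_natCast (hf : PowerSeries.constantCoeff f = 1) (p : K) (k : ℕ) :
    spow f (p * k) = spow f p ^ k := by
  rw [spow, binSeries_natCast_mul, PowerSeries.subst_pow (hasSubst_sub_one hf)]; rfl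

/-- Two power series agree up to order `N`. -/
def AgreeTo (N : ℕ) {R : Type*} [CommRing R] (f g : PowerSeries R) : Prop :=
  PowerSeries.X ^ (N + 1) ∣ f - g

section Agree

variable {R : Type*} [CommRing R] {N : ℕ} {f g f' g' : PowerSeries R}

theorem agreeTo_iff : AgreeTo N f g ↔ ∀ n ≤ N, PowerSeries.coeff n f = PowerSeries.coeff n g := by
  rw [AgreeTo, PowerSeries.X_pow_dvd_iff]
  simp [sub_eq_zero]

theorem AgreeTo.rfl : AgreeTo N f f := agreeTo_iff.2 fun _ _ => _root_.rfl

theorem AgreeTo.symm (h : AgreeTo N f g) : AgreeTo N g f :=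
  agreeTo_iff.2 fun n hn => (agreeTo_iff.1 h n hn).symm

theorem AgreeTo.trans (h : AgreeTo N f g) (h' : AgreeTo N g f') : AgreeTo N f f' :=
  agreeTo_iff.2 fun n hn => (agreeTo_iff.1 h n hn).trans (agreeTo_iff.1 h' n hn)

theorem AgreeTo.sub (h : AgreeTo N f g) (h' : AgreeTo N f' g') : AgreeTo N (f - f') (g - g') := by
  have := dvd_sub h h'
  rwa [AgreeTo, sub_sub_sub_comm]

theorem AgreeTo.mul (h : AgreeTo N f g) (h' : AgreeTo N f' g') : AgreeTo N (f * f') (g * g') := by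
  have : f * f' - g * g' = (f - g) * f' + g * (f' - g') := by ring
  rw [AgreeTo, this]
  exact dvd_add (h.mul_right _) (h'.mul_left _)

theorem AgreeTo.pow (h : AgreeTo N f g) (k : ℕ) : AgreeTo N (f ^ k) (g ^ k) :=
  dvd_trans h (sub_dvd_pow_sub_pow f g k)

theorem AgreeTo.sum {ι : Type*} (s : Finset ι) {f g : ι → PowerSeries R}
    (h : ∀ i ∈ s, AgreeTo N (f i) (g i)) : AgreeTo N (∑ i ∈ s, f i) (∑ i ∈ s, g i) := by
  rw [AgreeTo, ← sum_sub_distrib]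
  exact dvd_sum h

theorem AgreeTo.prod {ι : Type*} (s : Finset ι) {f g : ι → PowerSeries R}
    (h : ∀ i ∈ s, AgreeTo N (f i) (g i)) : AgreeTo N (∏ i ∈ s, f i) (∏ i ∈ s, g i) := by
  classical
  induction s using Finset.induction_on with
  | empty => exact AgreeTo.rfl
  | insert i s hi ih =>
    rw [prod_insert hi, prod_insert hi]
    exact (h i (mem_insert_self i s)).mul (ih fun j hj => h j (mem_insert_of_mem hj))

theorem coeff_pow_eq_zero {f : PowerSeries R} (hf : PowerSeries.constantCoeff f = 0) {n r : ℕ}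
    (h : n < r) : PowerSeries.coeff n (f ^ r) = 0 :=
  PowerSeries.X_pow_dvd_iff.1 (pow_dvd_pow_of_dvd (PowerSeries.X_dvd_iff.2 hf) r) n h

end Agree

/-- Truncation of the binomial series. -/
theorem spow_agreeTo (hf : PowerSeries.constantCoeff f = 1) (p : K) (N : ℕ) :
    AgreeTo N (spow f p) (∑ r ∈ range (N + 1), PowerSeries.C (C (binCoeff p r)) * (f - 1) ^ r) := by
  refine agreeTo_iff.2 fun n hn => ?_
  rw [spow, PowerSeries.coeff_subst' (hasSubst_sub_one hf), map_sum,
    finsum_eq_sum_of_support_subset (s := range (N + 1))]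
  · refine sum_congr rfl fun r _ => ?_
    rw [coeff_binSeries, PowerSeries.coeff_C_mul, smul_eq_C_mul]
  · intro r hr
    by_contra h
    refine hr ?_
    simp only [coe_range, Set.mem_Iio, not_lt] at h
    dsimp only
    rw [coeff_pow_eq_zero (by simp [hf]) (by omega), smul_zero]

/-- Up to order N both powers are given by one and the same polynomial in f - 1 and g - 1, and
polynomials respect agreement. -/
theorem AgreeTo.spow {N : ℕ} {g : PowerSeries K[X]} (hf : PowerSeries.constantCoeff f = 1)
    (hg : PowerSeries.constantCoeff g = 1) (h : AgreeTo N f g) (p : K) :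
    AgreeTo N (spow f p) (spow g p) :=
  (spow_agreeTo hf p N).trans <| .trans
    (AgreeTo.sum _ fun r _ => AgreeTo.rfl.mul ((h.sub AgreeTo.rfl).pow r))
    (spow_agreeTo hg p N).symm

end BinomialPowers

/-! ### Coefficient form of the system and uniqueness of its solution. -/

section Uniqueness

variable {K : Type*} [CommRing K] [Algebra ℚ K] {A : Type*} [Fintype A]

theorem AgreeTo.mul_Qser_pow {N : ℕ} (s : A → K) {G G' : A → PowerSeries K[X]}
    (hG : ∀ a, PowerSeries.constantCoeff (G a) = 1)
    (hG' : ∀ a, PowerSeries.constantCoeff (G' a) = 1)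
    (h : ∀ a, AgreeTo N (G a) (G' a)) (a : A) (k : ℕ) :
    AgreeTo N (G a * Qser s G ^ k) (G' a * Qser s G' ^ k) :=
  (h a).mul ((AgreeTo.prod _ fun b _ => (h b).spow (hG b) (hG' b) (s b)).pow k)

omit [Algebra ℚ K] in
/-- The right-hand side of the system in degree `n`. -/
theorem coeff_formalSum_X_pow_mul (H : ℕ+ → PowerSeries K[X]) (n : ℕ) :
    PowerSeries.coeff n (formalSum fun k : ℕ+ => PowerSeries.X ^ (k : ℕ) * H k) =
      ∑ j ∈ range n, PowerSeries.coeff (n - (j + 1)) (H j.succPNat) := by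
  rw [formalSum, PowerSeries.coeff_mk, ← finsum_comp_equiv Equiv.pnatEquivNat.symm,
    finsum_eq_sum_of_support_subset (s := range n)]
  · refine sum_congr rfl fun j hj => ?_
    rw [Equiv.pnatEquivNat_symm_apply, PowerSeries.coeff_X_pow_mul', if_pos]
    · rfl
    · simpa using hj
  · intro j hj
    by_contra h
    refine hj ?_
    dsimp only
    rw [Equiv.pnatEquivNat_symm_apply, PowerSeries.coeff_X_pow_mul', if_neg]
    simpa using h

/-- The recursion for the coefficients of a solution. -/
theorem equation_iff_coeff (s : A → K) (c : ℕ → A × ℕ+ → K) (G : A → PowerSeries K[X]) (a : A) :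
    (G a = 1 + formalSum fun k : ℕ+ =>
      PowerSeries.X ^ (k : ℕ) * LamSeries (fun n => c n (a, k)) (G a * Qser s G ^ (k : ℕ))) ↔
    ∀ n, PowerSeries.coeff n (G a) = PowerSeries.coeff n (1 : PowerSeries K[X]) +
      ∑ j ∈ range n, Lam (fun i => c i (a, j.succPNat))
        (PowerSeries.coeff (n - (j + 1)) (G a * Qser s G ^ (j + 1))) := by
  have h := coeff_formalSum_X_pow_mul (fun k : ℕ+ => LamSeries (fun n => c n (a, k))
    (G a * Qser s G ^ (k : ℕ)))
  simp only [LamSeries, PowerSeries.coeff_mk, Nat.succPNat_coe, Nat.succ_eq_add_one] at h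
  rw [PowerSeries.ext_iff]
  refine forall_congr' fun n => ?_
  rw [map_add, ← h n]
  rfl

/-- As k ≥ 1, the right-hand side in degree n sees only coefficients of degree below n. Agreement up
to order N thus propagates to order N + 1, for all types simultaneously. -/
theorem IsSolution.unique {s : A → K} {c : ℕ → A × ℕ+ → K} {G G' : A → PowerSeries K[X]}
    (hG : IsSolution s c G) (hG' : IsSolution s c G') (a : A) : G a = G' a := by
  have key : ∀ N, ∀ a, AgreeTo N (G a) (G' a) := by
    intro N
    induction N with
    | zero =>
      intro a
      refine agreeTo_iff.2 fun n hn => ?_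
      obtain rfl : n = 0 := by omega
      rw [PowerSeries.coeff_zero_eq_constantCoeff, hG.constantCoeff_eq_one,
        hG'.constantCoeff_eq_one]
    | succ N ih =>
      intro a
      refine agreeTo_iff.2 fun n hn => ?_
      refine ((equation_iff_coeff s c G a).1 (hG.equation a) n).trans
        (.trans ?_ ((equation_iff_coeff s c G' a).1 (hG'.equation a) n).symm)
      refine congrArg _ (sum_congr rfl fun j hj => congrArg _ ?_)
      have := mem_range.1 hj
      exact agreeTo_iff.1 (AgreeTo.mul_Qser_pow s hG.constantCoeff_eq_one
        hG'.constantCoeff_eq_one ih a _) _ (by omega)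
  ext1 n
  exact agreeTo_iff.1 (key n a) n le_rfl

/-- Absorbing the extra factor G_a as an added exponent 1 explains the asymmetric parameter 1 + s_a
k in ξ. -/
theorem mul_Qser_pow [DecidableEq A] (s : A → K) {G : A → PowerSeries K[X]}
    (hG : ∀ a, PowerSeries.constantCoeff (G a) = 1) (a : A) (k : ℕ) :
    G a * Qser s G ^ k =
      ∏ b, spow (G b) (if b = a then 1 + s b * (k : K) else s b * (k : K)) := by
  have h : ∀ b, spow (G b) (if b = a then 1 + s b * (k : K) else s b * (k : K)) =
      (if b = a then G b else 1) * spow (G b) (s b) ^ k := by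
    intro b
    split_ifs
    · rw [spow_add (hG b), spow_one (hG b), spow_mul_natCast (hG b)]
    · rw [spow_mul_natCast (hG b), one_mul]
  simp_rw [h, prod_mul_distrib, prod_ite_eq', mem_univ, if_true, prod_pow, Qser]

end Uniqueness

namespace DecTree

/-! ### Descendants and depth in a rooted tree. -/

section Descendants

variable {D V : Type*} (t : DecTree D V)

/-- `u` is `v` or a descendant of `v`. -/
def Below (u v : V) : Prop := ∃ n : ℕ, t.parent^[n] u = v

variable {t} {u v w : V}

theorem Below.refl (u : V) : t.Below u u := ⟨0, rfl⟩

theorem Below.trans (h : t.Below u v) (h' : t.Below v w) : t.Below u w := by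
  obtain ⟨n, rfl⟩ := h
  obtain ⟨m, rfl⟩ := h'
  exact ⟨m + n, Function.iterate_add_apply _ _ _ _⟩

theorem below_root (u : V) : t.Below u t.root := t.reaches_root u

theorem below_parent (u : V) : t.Below u (t.parent u) := ⟨1, rfl⟩

theorem Below.parent_of_ne (h : t.Below u v) (hne : u ≠ v) : t.Below (t.parent u) v := by
  obtain ⟨n, rfl⟩ := h
  cases n with
  | zero => exact absurd rfl hne
  | succ n => exact ⟨n, (Function.iterate_succ_apply _ _ _).symm⟩

theorem Below.total (h : t.Below u v) (h' : t.Below u w) : t.Below v w ∨ t.Below w v := by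
  obtain ⟨n, rfl⟩ := h
  obtain ⟨m, rfl⟩ := h'
  rcases le_total n m with hnm | hnm <;> obtain ⟨k, rfl⟩ := Nat.exists_eq_add_of_le hnm
  · exact .inl ⟨k, by rw [← Function.iterate_add_apply, add_comm]⟩
  · exact .inr ⟨k, by rw [← Function.iterate_add_apply, add_comm]⟩

theorem iterate_parent_root (n : ℕ) : t.parent^[n] t.root = t.root :=
  Function.iterate_fixed t.parent_root n

theorem parent_ne_self (h : u ≠ t.root) : t.parent u ≠ u := by
  intro h'
  obtain ⟨n, hn⟩ := t.reaches_root u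
  rw [Function.iterate_fixed h'] at hn
  exact h hn

open scoped Classical in
/-- The distance of a vertex from the root. -/
def depth (t : DecTree D V) (u : V) : ℕ := Nat.find (t.reaches_root u)

theorem depth_eq_zero : t.depth u = 0 ↔ u = t.root := by
  classical
  simp [depth, Nat.find_eq_zero]

theorem depth_parent (h : u ≠ t.root) : t.depth (t.parent u) + 1 = t.depth u := by
  classical
  symm
  refine Nat.find_comp_succ (t.reaches_root u) (t.reaches_root (t.parent u)) h

theorem depth_parent_le (u : V) : t.depth (t.parent u) ≤ t.depth u := by
  by_cases h : u = t.root
  · rw [h, t.parent_root]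
  · have := depth_parent h; omega

theorem Below.depth_le (h : t.Below u v) : t.depth v ≤ t.depth u := by
  obtain ⟨n, rfl⟩ := h
  induction n with
  | zero => exact le_rfl
  | succ n ih =>
    rw [Function.iterate_succ_apply']
    exact (depth_parent_le _).trans ih

theorem Below.antisymm (h : t.Below u v) (h' : t.Below v u) : u = v := by
  by_contra hne
  have h1 := (h.parent_of_ne hne).depth_le
  have h2 := h'.depth_le
  by_cases hu : u = t.root
  · subst hu
    obtain ⟨n, rfl⟩ := h
    exact hne (iterate_parent_root n).symm
  · have := depth_parent hu; omega

theorem IsChild.below (h : t.IsChild u v) : t.Below u v := ⟨1, h.2⟩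

theorem IsChild.ne (h : t.IsChild u v) : u ≠ v := by
  rintro rfl
  exact parent_ne_self h.1 h.2

theorem IsChild.depth (h : t.IsChild u v) : t.depth u = t.depth v + 1 := by
  rw [← depth_parent h.1, h.2]

/-- A proper descendant of `v` lies below a unique child of `v`. -/
theorem Below.exists_child (h : t.Below u v) (hne : u ≠ v) :
    ∃ w, t.IsChild w v ∧ t.Below u w := by
  obtain ⟨n, rfl⟩ := h
  induction n with
  | zero => exact absurd rfl hne
  | succ n ih =>
    by_cases hn : t.parent^[n] u = t.root
    · rw [Function.iterate_succ_apply', hn, t.parent_root, ← hn] at hne ⊢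
      exact ih hne
    · exact ⟨t.parent^[n] u, ⟨hn, (Function.iterate_succ_apply' _ _ _).symm⟩, n, rfl⟩

theorem IsChild.eq_of_below (h : t.IsChild u w) (h' : t.IsChild v w) (hb : t.Below u v) :
    u = v := by
  by_contra hne
  have := (hb.parent_of_ne hne).depth_le
  rw [h.2, h'.depth] at this
  omega

theorem IsChild.eq_of_below_of_below {x : V} (h : t.IsChild u w) (h' : t.IsChild v w)
    (hu : t.Below x u) (hv : t.Below x v) : u = v :=
  (hu.total hv).elim (h.eq_of_below h') fun hb => (h'.eq_of_below h hb).symm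

end Descendants

/-! ### Tubes described through their roots. -/

section RootedTubes

variable {D V : Type*} (t : DecTree D V)

/-- `S` is a tube with root `r`. -/
def IsRootedTube (r : V) (S : Finset V) : Prop :=
  r ∈ S ∧ ∀ u ∈ S, u ≠ r → u ≠ t.root ∧ t.parent u ∈ S

variable {t} {r r' u v : V} {S : Finset V}

theorem IsRootedTube.below (h : t.IsRootedTube r S) (hu : u ∈ S) : t.Below u r := by
  induction hn : t.depth u using Nat.strong_induction_on generalizing u with
  | _ n ih =>
    by_cases hr : u = r
    · rw [hr]; exact .refl r
    · obtain ⟨h1, h2⟩ := h.2 u hu hr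
      have := depth_parent h1
      exact (below_parent u).trans (ih _ (by omega) h2 rfl)

theorem IsRootedTube.mem_of_below (h : t.IsRootedTube r S) (hu : u ∈ S) (huv : t.Below u v)
    (hvr : t.Below v r) : v ∈ S := by
  induction hn : t.depth u using Nat.strong_induction_on generalizing u with
  | _ n ih =>
    by_cases he : u = v
    · rwa [← he]
    · have hr : u ≠ r := by
        rintro rfl
        exact he (huv.antisymm hvr)
      obtain ⟨h1, h2⟩ := h.2 u hu hr
      have := depth_parent h1
      exact ih _ (by omega) h2 (huv.parent_of_ne he) rfl

theorem IsRootedTube.isTubeRoot_iff (h : t.IsRootedTube r S) : t.IsTubeRoot v S ↔ v = r := by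
  constructor
  · intro hv
    exact (h.below hv.1).antisymm (hv.2 r h.1)
  · rintro rfl
    exact ⟨h.1, fun u hu => h.below hu⟩

theorem graph_adj_parent (h : u ≠ t.root) : t.graph.Adj u (t.parent u) := by
  rw [graph, SimpleGraph.fromRel_adj]
  exact ⟨(parent_ne_self h).symm, .inl rfl⟩

theorem graph_adj_iff : t.graph.Adj u v ↔ u ≠ v ∧ (t.parent u = v ∨ t.parent v = u) :=
  SimpleGraph.fromRel_adj _ _ _

/-- The root of a connected set is a vertex of minimal depth. Conversely, moving to parents inside
the set connects every vertex to the root. -/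
theorem isTube_iff : t.IsTube S ↔ ∃ r, t.IsRootedTube r S := by
  constructor
  · intro h
    have hne : S.Nonempty := by
      obtain ⟨x⟩ := h.nonempty
      exact ⟨x.1, x.2⟩
    obtain ⟨r, hr, hmin⟩ := S.exists_min_image t.depth hne
    refine ⟨r, hr, ?_⟩
    let P : V → Prop := fun u => u = r ∨ (u ≠ t.root ∧ t.parent u ∈ S)
    suffices hP : ∀ u : (S : Set V), P u from fun u hu hur => (hP ⟨u, hu⟩).resolve_left hur
    -- The property "the chain of parents reaches r without leaving S" holds at r and is carried
    -- along walks inside S.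
    suffices hQ : ∀ u : (S : Set V),
        ∃ n, t.parent^[n] (u : V) = r ∧ ∀ m ≤ n, t.parent^[m] (u : V) ∈ S by
      intro u
      obtain ⟨n, hn, hm⟩ := hQ u
      by_cases hur : (u : V) = r
      · exact .inl hur
      · cases n with
        | zero => exact absurd hn hur
        | succ n =>
          refine .inr ⟨fun hroot => hur ?_, hm 1 (by omega)⟩
          rw [← hn, hroot, iterate_parent_root]
    intro u
    obtain ⟨p⟩ := h.preconnected ⟨r, hr⟩ u
    suffices key : ∀ (x y : (S : Set V)) (p : (t.graph.induce (S : Set V)).Walk x y),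
        (∃ n, t.parent^[n] (x : V) = r ∧ ∀ m ≤ n, t.parent^[m] (x : V) ∈ S) →
        ∃ n, t.parent^[n] (y : V) = r ∧ ∀ m ≤ n, t.parent^[m] (y : V) ∈ S from
      key _ _ p ⟨0, rfl, fun m hm => by obtain rfl : m = 0 := (by omega); exact hr⟩
    intro x y p
    induction p with
    | nil => exact id
    | @cons x y z hxy p ih =>
      rintro ⟨n, hn, hm⟩
      refine ih ?_
      have hadj : t.graph.Adj (x : V) y := hxy
      rcases (graph_adj_iff.1 hadj).2 with hp | hp
      · cases n with
        | succ n =>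
          refine ⟨n, ?_, fun m hmn => ?_⟩
          · rw [← hp, ← Function.iterate_succ_apply, hn]
          · rw [← hp, ← Function.iterate_succ_apply]
            exact hm _ (by omega)
        -- A step from r to its parent would reach a vertex of S of smaller depth, against the
        -- choice of r.
        | zero =>
          exfalso
          have hx : (x : V) = r := hn
          by_cases hroot : (x : V) = t.root
          · exact hadj.ne (by rw [← hp, hroot, t.parent_root])
          · have h1 := depth_parent hroot
            have h2 := hmin y y.2
            rw [← hp] at h2
            rw [hx] at h1 h2
            omega
      · refine ⟨n + 1, ?_, fun m hmn => ?_⟩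
        · rw [Function.iterate_succ_apply, hp, hn]
        · cases m with
          | zero => exact y.2
          | succ m =>
            rw [Function.iterate_succ_apply, hp]
            exact hm _ (by omega)
  · rintro ⟨r, h⟩
    have key : ∀ (u : V) (hu : u ∈ S),
        (t.graph.induce (S : Set V)).Reachable ⟨u, hu⟩ ⟨r, h.1⟩ := by
      intro u hu
      induction hn : t.depth u using Nat.strong_induction_on generalizing u with
      | _ n ih =>
        by_cases hr : u = r
        · subst hr; rfl
        · obtain ⟨h1, h2⟩ := h.2 u hu hr
          have := depth_parent h1
          refine SimpleGraph.Reachable.trans ?_ (ih _ (by omega) (t.parent u) h2 rfl)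
          exact SimpleGraph.Adj.reachable (graph_adj_parent h1)
    have : Nonempty (S : Set V) := ⟨⟨r, h.1⟩⟩
    exact ⟨fun x y => (key x x.2).trans (key y y.2).symm⟩

end RootedTubes

end DecTree

namespace DecTree

/-! ### Cutting a tube at an edge. -/

section Cutting

variable {D V : Type*} [Fintype V] [DecidableEq V] (t : DecTree D V)

open scoped Classical in
/-- The set of all descendants of `v`, including `v` itself. -/
def desc (v : V) : Finset V := univ.filter fun u => t.Below u v

variable {t} {r u v w : V} {S : Finset V}

omit [DecidableEq V] in
@[simp] theorem mem_desc : u ∈ t.desc v ↔ t.Below u v := by simp [desc]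

omit [DecidableEq V] in
theorem desc_root : t.desc t.root = univ := by
  ext u; simp [below_root]

omit [DecidableEq V] in
theorem isRootedTube_desc (v : V) : t.IsRootedTube v (t.desc v) := by
  refine ⟨mem_desc.2 (.refl v), fun u hu huv => ⟨?_, mem_desc.2 ?_⟩⟩
  · rintro rfl
    exact huv ((mem_desc.1 hu).antisymm (below_root v))
  · exact (mem_desc.1 hu).parent_of_ne huv

theorem IsRootedTube.inter_desc (h : t.IsRootedTube r S) (hv : v ∈ S) :
    t.IsRootedTube v (S ∩ t.desc v) := by
  refine ⟨mem_inter.2 ⟨hv, mem_desc.2 (.refl v)⟩, fun u hu huv => ?_⟩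
  obtain ⟨huS, hud⟩ := mem_inter.1 hu
  have hur : u ≠ r := by
    rintro rfl
    exact huv ((mem_desc.1 hud).antisymm (h.below hv))
  obtain ⟨h1, h2⟩ := h.2 u huS hur
  exact ⟨h1, mem_inter.2 ⟨h2, mem_desc.2 ((mem_desc.1 hud).parent_of_ne huv)⟩⟩

omit [DecidableEq V] in
theorem IsRootedTube.not_mem_desc (h : t.IsRootedTube r S) (hv : v ∈ S) (hvr : v ≠ r) :
    r ∉ t.desc v := fun hr => hvr ((h.below hv).antisymm (mem_desc.1 hr))

theorem IsRootedTube.sdiff_desc (h : t.IsRootedTube r S) (hv : v ∈ S) (hvr : v ≠ r) :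
    t.IsRootedTube r (S \ t.desc v) := by
  refine ⟨mem_sdiff.2 ⟨h.1, h.not_mem_desc hv hvr⟩, fun u hu hur => ?_⟩
  obtain ⟨huS, hud⟩ := mem_sdiff.1 hu
  obtain ⟨h1, h2⟩ := h.2 u huS hur
  exact ⟨h1, mem_sdiff.2 ⟨h2, fun hp => hud (mem_desc.2 ((below_parent u).trans (mem_desc.1 hp)))⟩⟩

/-- A partition of a rooted tube into two rooted tubes is obtained by cutting an edge. -/
theorem IsRootedTube.eq_of_partition {S₁ S₂ : Finset V} {r₁ r₂ : V} (h : t.IsRootedTube r S)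
    (h₁ : t.IsRootedTube r₁ S₁) (h₂ : t.IsRootedTube r₂ S₂) (hd : Disjoint S₁ S₂)
    (hS : S₁ ∪ S₂ = S) (hr : r ∈ S₁) :
    r₂ ∈ S.erase r ∧ S₁ = S \ t.desc r₂ ∧ S₂ = S ∩ t.desc r₂ := by
  have hr1 : r₁ = r := (h.below (hS ▸ mem_union_left _ h₁.1)).antisymm (h₁.below hr)
  subst hr1
  have hr2S : r₂ ∈ S := hS ▸ mem_union_right _ h₂.1
  have key1 : ∀ u ∈ S₁, u ∉ t.desc r₂ := fun u hu hud =>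
    disjoint_left.1 hd (h₁.mem_of_below hu (mem_desc.1 hud) (h.below hr2S)) h₂.1
  have key2 : ∀ u ∈ S₂, u ∈ t.desc r₂ := fun u hu => mem_desc.2 (h₂.below hu)
  refine ⟨mem_erase.2 ⟨?_, hr2S⟩, ?_, ?_⟩
  · rintro rfl
    exact disjoint_left.1 hd hr h₂.1
  · ext u
    rw [mem_sdiff, ← hS, mem_union]
    constructor
    · exact fun hu => ⟨.inl hu, key1 u hu⟩
    · rintro ⟨hu | hu, hud⟩
      · exact hu
      · exact absurd (key2 u hu) hud
  · ext u
    rw [mem_inter, ← hS, mem_union]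
    constructor
    · exact fun hu => ⟨.inr hu, key2 u hu⟩
    · rintro ⟨hu | hu, hud⟩
      · exact absurd hud (key1 u hu)
      · exact hu

end Cutting

/-! ### The recursive structure of binary tubings. -/

section TubingsOf

variable {D V : Type*} [Fintype V] [DecidableEq V] (t : DecTree D V)

/-- Binary tubings of a tube `S`. -/
structure IsTubingOf (S : Finset V) (τ : Finset (Finset V)) : Prop where
  isTube : ∀ b ∈ τ, ∃ r, t.IsRootedTube r b
  subset : ∀ b ∈ τ, b ⊆ S
  mem : S ∈ τ
  nested : ∀ b ∈ τ, ∀ b' ∈ τ, b ⊆ b' ∨ b' ⊆ b ∨ Disjoint b b'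
  partition : ∀ b ∈ τ, b.card = 1 ∨ ∃ b₁ ∈ τ, ∃ b₂ ∈ τ, Disjoint b₁ b₂ ∧ b₁ ∪ b₂ = b

open scoped Classical in
/-- The set of all binary tubings of a tube `S`. -/
def tubingsOf (S : Finset V) : Finset (Finset (Finset V)) :=
  univ.filter fun τ => t.IsTubingOf S τ

variable {t} {r u v w : V} {S : Finset V} {τ τ₁ τ₂ : Finset (Finset V)}

theorem mem_tubingsOf : τ ∈ t.tubingsOf S ↔ t.IsTubingOf S τ := by simp [tubingsOf]

theorem tubings_eq_tubingsOf : t.tubings = t.tubingsOf univ := by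
  ext τ
  simp only [tubings, tubingsOf, mem_filter, mem_univ, true_and]
  constructor
  · exact fun h => ⟨fun b hb => isTube_iff.1 (h.isTube b hb), fun b _ => subset_univ b,
      h.univ_mem, h.nested, h.partition⟩
  · exact fun h => ⟨fun b hb => isTube_iff.2 (h.isTube b hb), h.mem, h.nested, h.partition⟩

omit [Fintype V] in
theorem IsTubingOf.nonempty (h : t.IsTubingOf S τ) {b : Finset V} (hb : b ∈ τ) : b.Nonempty := by
  obtain ⟨r, hr⟩ := h.isTube b hb
  exact ⟨r, hr.1⟩

/-- Grafting tubings of the two parts of a tube. -/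
def graft (S : Finset V) (τ₁ τ₂ : Finset (Finset V)) : Finset (Finset V) := insert S (τ₁ ∪ τ₂)

theorem IsRootedTube.isTubingOf_graft (h : t.IsRootedTube r S) (hv : v ∈ S.erase r)
    (h₁ : t.IsTubingOf (S \ t.desc v) τ₁) (h₂ : t.IsTubingOf (S ∩ t.desc v) τ₂) :
    t.IsTubingOf S (graft S τ₁ τ₂) := by
  have hd : Disjoint (S \ t.desc v) (S ∩ t.desc v) := by
    rw [disjoint_left]
    intro u hu hu'
    exact (mem_sdiff.1 hu).2 (mem_inter.1 hu').2
  have hsub : ∀ b ∈ graft S τ₁ τ₂, b ⊆ S := by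
    intro b hb
    rcases mem_insert.1 hb with rfl | hb
    · exact Subset.rfl
    rcases mem_union.1 hb with hb | hb
    · exact (h₁.subset b hb).trans sdiff_subset
    · exact (h₂.subset b hb).trans inter_subset_left
  have hm₁ : ∀ b ∈ τ₁, b ∈ graft S τ₁ τ₂ := fun b hb =>
    mem_insert_of_mem (mem_union_left _ hb)
  have hm₂ : ∀ b ∈ τ₂, b ∈ graft S τ₁ τ₂ := fun b hb =>
    mem_insert_of_mem (mem_union_right _ hb)
  refine ⟨fun b hb => ?_, hsub, mem_insert_self _ _, fun b hb b' hb' => ?_, fun b hb => ?_⟩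
  · rcases mem_insert.1 hb with rfl | hb
    · exact ⟨r, h⟩
    rcases mem_union.1 hb with hb | hb
    · exact h₁.isTube b hb
    · exact h₂.isTube b hb
  · rcases mem_insert.1 hb with rfl | hb1
    · exact .inr (.inl (hsub b' hb'))
    rcases mem_insert.1 hb' with rfl | hb1'
    · exact .inl (hsub b hb)
    rcases mem_union.1 hb1 with hb2 | hb2 <;> rcases mem_union.1 hb1' with hb2' | hb2'
    · exact h₁.nested b hb2 b' hb2'
    · exact .inr (.inr (hd.mono (h₁.subset b hb2) (h₂.subset b' hb2')))
    · exact .inr (.inr (hd.symm.mono (h₂.subset b hb2) (h₁.subset b' hb2')))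
    · exact h₂.nested b hb2 b' hb2'
  · rcases mem_insert.1 hb with rfl | hb
    · exact .inr ⟨_, hm₁ _ h₁.mem, _, hm₂ _ h₂.mem, hd, sdiff_union_inter b _⟩
    rcases mem_union.1 hb with hb | hb
    · refine (h₁.partition b hb).imp_right ?_
      rintro ⟨b₁, hb₁, b₂, hb₂, hh⟩
      exact ⟨b₁, hm₁ _ hb₁, b₂, hm₁ _ hb₂, hh⟩
    · refine (h₂.partition b hb).imp_right ?_
      rintro ⟨b₁, hb₁, b₂, hb₂, hh⟩
      exact ⟨b₁, hm₂ _ hb₁, b₂, hm₂ _ hb₂, hh⟩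

/-- Tubes are nonempty and the two parts are disjoint, so a tube of the graft determines the half it
came from. This gives injectivity of grafting once the cut is known. -/
theorem IsRootedTube.filter_graft (h : t.IsRootedTube r S) (hv : v ∈ S.erase r)
    (h₁ : t.IsTubingOf (S \ t.desc v) τ₁) (h₂ : t.IsTubingOf (S ∩ t.desc v) τ₂) :
    (graft S τ₁ τ₂).filter (· ⊆ S \ t.desc v) = τ₁ ∧
      (graft S τ₁ τ₂).filter (· ⊆ S ∩ t.desc v) = τ₂ := by
  obtain ⟨hvr, hvS⟩ := mem_erase.1 hv
  have hvd : v ∈ t.desc v := mem_desc.2 (.refl v)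
  have hrd := h.not_mem_desc hvS hvr
  constructor
  · ext b
    simp only [graft, mem_filter, mem_insert, mem_union]
    constructor
    · rintro ⟨rfl | hb | hb, hs⟩
      · exact absurd hvd (mem_sdiff.1 (hs hvS)).2
      · exact hb
      · obtain ⟨x, hx⟩ := h₂.nonempty hb
        exact absurd (mem_inter.1 (h₂.subset b hb hx)).2 (mem_sdiff.1 (hs hx)).2
    · exact fun hb => ⟨.inr (.inl hb), h₁.subset b hb⟩
  · ext b
    simp only [graft, mem_filter, mem_insert, mem_union]
    constructor
    · rintro ⟨rfl | hb | hb, hs⟩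
      · exact absurd (mem_inter.1 (hs h.1)).2 hrd
      · obtain ⟨x, hx⟩ := h₁.nonempty hb
        exact absurd (mem_inter.1 (hs hx)).2 (mem_sdiff.1 (h₁.subset b hb hx)).2
      · exact hb
    · exact fun hb => ⟨.inr (.inr hb), h₂.subset b hb⟩

/-- Used in both directions, this shows that the cut vertex is determined by the tubing: both halves
at v must fit into halves at w. -/
theorem IsRootedTube.below_of_graft_eq {σ₁ σ₂ : Finset (Finset V)} (h : t.IsRootedTube r S)
    (hv : v ∈ S.erase r) (hw : w ∈ S.erase r)
    (h₁ : t.IsTubingOf (S \ t.desc v) τ₁) (h₂ : t.IsTubingOf (S ∩ t.desc v) τ₂)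
    (k₁ : t.IsTubingOf (S \ t.desc w) σ₁) (k₂ : t.IsTubingOf (S ∩ t.desc w) σ₂)
    (he : graft S τ₁ τ₂ = graft S σ₁ σ₂) : t.Below v w := by
  obtain ⟨hvr, hvS⟩ := mem_erase.1 hv
  obtain ⟨hwr, hwS⟩ := mem_erase.1 hw
  have hvd : v ∈ t.desc v := mem_desc.2 (.refl v)
  have hrd := h.not_mem_desc hvS hvr
  have hrw := h.not_mem_desc hwS hwr
  have m1 : S \ t.desc v ∈ graft S σ₁ σ₂ := he ▸ mem_insert_of_mem (mem_union_left _ h₁.mem)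
  have m2 : S ∩ t.desc v ∈ graft S σ₁ σ₂ := he ▸ mem_insert_of_mem (mem_union_right _ h₂.mem)
  have m2' : S ∩ t.desc v ⊆ S \ t.desc w ∨ S ∩ t.desc v ⊆ S ∩ t.desc w := by
    rcases mem_insert.1 m2 with h' | h'
    · exact absurd (mem_inter.1 (h'.symm ▸ h.1)).2 hrd
    · exact (mem_union.1 h').imp (k₁.subset _) (k₂.subset _)
  have m1' : S \ t.desc v ⊆ S \ t.desc w := by
    rcases mem_insert.1 m1 with h' | h'
    · exact absurd hvd (mem_sdiff.1 (h'.symm ▸ hvS)).2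
    · rcases mem_union.1 h' with h' | h'
      · exact k₁.subset _ h'
      · exact absurd (mem_inter.1 (k₂.subset _ h' (mem_sdiff.2 ⟨h.1, hrd⟩))).2 hrw
  rcases m2' with h' | h'
  -- If both halves at v avoided the descendants of w, the vertex w itself would lie in neither
  -- half.
  · exfalso
    have hwd : w ∈ t.desc w := mem_desc.2 (.refl w)
    by_cases hwv : w ∈ t.desc v
    · exact (mem_sdiff.1 (h' (mem_inter.2 ⟨hwS, hwv⟩))).2 hwd
    · exact (mem_sdiff.1 (m1' (mem_sdiff.2 ⟨hwS, hwv⟩))).2 hwd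
  · exact mem_desc.1 (mem_inter.1 (h' (mem_inter.2 ⟨hvS, hvd⟩))).2

omit [Fintype V] in
theorem IsTubingOf.filter_subset {S' : Finset V} (h : t.IsTubingOf S τ) (hS' : S' ∈ τ) :
    t.IsTubingOf S' (τ.filter (· ⊆ S')) := by
  refine ⟨fun b hb => h.isTube b (mem_filter.1 hb).1, fun b hb => (mem_filter.1 hb).2,
    mem_filter.2 ⟨hS', Subset.rfl⟩,
    fun b hb b' hb' => h.nested b (mem_filter.1 hb).1 b' (mem_filter.1 hb').1, fun b hb => ?_⟩
  obtain ⟨hb, hbs⟩ := mem_filter.1 hb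
  refine (h.partition b hb).imp_right ?_
  rintro ⟨b₁, hb₁, b₂, hb₂, hd, rfl⟩
  exact ⟨b₁, mem_filter.2 ⟨hb₁, subset_union_left.trans hbs⟩,
    b₂, mem_filter.2 ⟨hb₂, subset_union_right.trans hbs⟩, hd, rfl⟩

/-- Every binary tubing of a tube with at least two vertices is obtained by grafting. -/
theorem IsTubingOf.exists_graft (h : t.IsRootedTube r S) (hS : 1 < S.card)
    (hτ : t.IsTubingOf S τ) :
    ∃ v ∈ S.erase r, ∃ τ₁ τ₂, t.IsTubingOf (S \ t.desc v) τ₁ ∧ t.IsTubingOf (S ∩ t.desc v) τ₂ ∧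
      graft S τ₁ τ₂ = τ := by
  have key : ∃ S₁ ∈ τ, ∃ S₂ ∈ τ, Disjoint S₁ S₂ ∧ S₁ ∪ S₂ = S ∧ r ∈ S₁ := by
    obtain ⟨b₁, hb₁, b₂, hb₂, hd, hu⟩ := (hτ.partition S hτ.mem).resolve_left (by omega)
    rcases mem_union.1 (hu.symm ▸ h.1) with hr | hr
    · exact ⟨b₁, hb₁, b₂, hb₂, hd, hu, hr⟩
    · exact ⟨b₂, hb₂, b₁, hb₁, hd.symm, by rw [union_comm, hu], hr⟩
  obtain ⟨S₁, hS₁, S₂, hS₂, hd, hu, hr⟩ := key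
  obtain ⟨r₁, hr₁⟩ := hτ.isTube S₁ hS₁
  obtain ⟨v, hv⟩ := hτ.isTube S₂ hS₂
  obtain ⟨hvS, e₁, e₂⟩ := h.eq_of_partition hr₁ hv hd hu hr
  refine ⟨v, hvS, τ.filter (· ⊆ S₁), τ.filter (· ⊆ S₂), e₁ ▸ hτ.filter_subset hS₁,
    e₂ ▸ hτ.filter_subset hS₂, ?_⟩
  ext b
  simp only [graft, mem_insert, mem_union, mem_filter]
  constructor
  · rintro (rfl | hb | hb)
    exacts [hτ.mem, hb.1, hb.1]
  · intro hb
    have hbS := hτ.subset b hb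
    -- Comparing `b` with both halves leaves two possibilities: it lies in one half, or it contains
    -- both and is all of S.
    rcases hτ.nested b hb S₁ hS₁ with h1 | h1 | h1
    · exact .inr (.inl ⟨hb, h1⟩)
    · rcases hτ.nested b hb S₂ hS₂ with h2 | h2 | h2
      · exact .inr (.inr ⟨hb, h2⟩)
      · exact .inl (hbS.antisymm (hu ▸ union_subset h1 h2))
      · refine .inr (.inl ⟨hb, fun x hx => ?_⟩)
        exact (mem_union.1 (hu.symm ▸ hbS hx)).resolve_right (disjoint_left.1 h2 hx)
    · refine .inr (.inr ⟨hb, fun x hx => ?_⟩)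
      exact (mem_union.1 (hu.symm ▸ hbS hx)).resolve_left (disjoint_left.1 h1 hx)

/-- Summation over the binary tubings of a tube by cutting an edge. -/
theorem IsRootedTube.sum_tubingsOf {M : Type*} [AddCommMonoid M] (h : t.IsRootedTube r S)
    (hS : 1 < S.card) (f : Finset (Finset V) → M) :
    ∑ τ ∈ t.tubingsOf S, f τ = ∑ v ∈ S.erase r, ∑ τ₁ ∈ t.tubingsOf (S \ t.desc v),
      ∑ τ₂ ∈ t.tubingsOf (S ∩ t.desc v), f (graft S τ₁ τ₂) := by
  simp_rw [← sum_product']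
  rw [sum_sigma']
  symm
  refine sum_nbij (fun x => graft S x.2.1 x.2.2) ?_ ?_ ?_ (fun _ _ => rfl)
  · rintro ⟨v, τ₁, τ₂⟩ hx
    simp only [mem_sigma, mem_product, mem_tubingsOf] at hx ⊢
    exact h.isTubingOf_graft hx.1 hx.2.1 hx.2.2
  · rintro ⟨v, τ₁, τ₂⟩ hx ⟨w, σ₁, σ₂⟩ hy he
    simp only [coe_sigma, Set.mem_sigma_iff, mem_coe, mem_product, mem_tubingsOf] at hx hy he
    obtain rfl : v = w :=
      (h.below_of_graft_eq hx.1 hy.1 hx.2.1 hx.2.2 hy.2.1 hy.2.2 he).antisymm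
        (h.below_of_graft_eq hy.1 hx.1 hy.2.1 hy.2.2 hx.2.1 hx.2.2 he.symm)
    have h1 := h.filter_graft hx.1 hx.2.1 hx.2.2
    have h2 := h.filter_graft hy.1 hy.2.1 hy.2.2
    rw [he] at h1
    obtain rfl := h1.1.symm.trans h2.1
    obtain rfl := h1.2.symm.trans h2.2
    rfl
  · intro τ hτ
    obtain ⟨v, hv, τ₁, τ₂, h₁, h₂, rfl⟩ := (mem_tubingsOf.1 hτ).exists_graft h hS
    refine ⟨⟨v, τ₁, τ₂⟩, ?_, rfl⟩
    simp only [coe_sigma, Set.mem_sigma_iff, mem_coe, mem_product, mem_tubingsOf]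
    exact ⟨hv, h₁, h₂⟩

omit [Fintype V] [DecidableEq V] in
theorem IsRootedTube.eq_singleton (h : t.IsRootedTube r S) (hS : S.card ≤ 1) : S = {r} :=
  eq_singleton_iff_unique_mem.2 ⟨h.1, fun _ hx => card_le_one.1 hS _ hx _ h.1⟩

theorem tubingsOf_singleton (r : V) : t.tubingsOf {r} = {{{r}}} := by
  ext τ
  rw [mem_tubingsOf, mem_singleton]
  constructor
  · refine fun h => eq_singleton_iff_unique_mem.2 ⟨h.mem, fun b hb => ?_⟩
    exact (subset_singleton_iff.1 (h.subset b hb)).resolve_left (h.nonempty hb).ne_empty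
  · rintro rfl
    refine ⟨fun b hb => ⟨r, ?_⟩, ?_, mem_singleton_self _, ?_, ?_⟩
    · rw [mem_singleton.1 hb]
      exact ⟨mem_singleton_self r, fun u hu hur => absurd (mem_singleton.1 hu) hur⟩
    · intro b hb; rw [mem_singleton.1 hb]
    · intro b hb b' hb'; rw [mem_singleton.1 hb, mem_singleton.1 hb']; exact .inl Subset.rfl
    · intro b hb; rw [mem_singleton.1 hb]; exact .inl (card_singleton r)

end TubingsOf

end DecTree

namespace DecTree

/-! ### Generating polynomials of tubings and their derivatives. -/

section TubingStatistics

variable {D V : Type*} [Fintype V] [DecidableEq V] {t : DecTree D V}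
  {r u v : V} {S : Finset V} {τ τ₁ τ₂ : Finset (Finset V)}

omit [Fintype V] in
theorem IsTubingOf.bStat_eq_zero (h : t.IsTubingOf S τ) (hu : u ∉ S) : t.bStat u τ = 0 := by
  classical
  rw [bStat, card_eq_zero, filter_eq_empty_iff]
  exact fun b hb hr => hu (h.subset b hb hr.1)

omit [Fintype V] in
theorem IsTubingOf.bStat_root_pos (h : t.IsTubingOf S τ) (hr : t.IsRootedTube r S) :
    0 < t.bStat r τ := by
  classical
  exact card_pos.2 ⟨S, mem_filter.2 ⟨h.mem, hr.isTubeRoot_iff.2 rfl⟩⟩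

/-- The graft is a disjoint union of the two families and the one new tube S, whose root is r. -/
theorem IsRootedTube.bStat_graft (h : t.IsRootedTube r S) (hv : v ∈ S.erase r)
    (h₁ : t.IsTubingOf (S \ t.desc v) τ₁) (h₂ : t.IsTubingOf (S ∩ t.desc v) τ₂) :
    t.bStat u (graft S τ₁ τ₂) = (if u = r then 1 else 0) + (t.bStat u τ₁ + t.bStat u τ₂) := by
  classical
  obtain ⟨hvr, hvS⟩ := mem_erase.1 hv
  have hd : Disjoint τ₁ τ₂ := by
    rw [disjoint_left]
    intro b hb hb'
    obtain ⟨x, hx⟩ := h₁.nonempty hb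
    exact (mem_sdiff.1 (h₁.subset b hb hx)).2 (mem_inter.1 (h₂.subset b hb' hx)).2
  have hS : S ∉ τ₁ ∪ τ₂ := by
    intro hS
    rcases mem_union.1 hS with hS | hS
    · exact (mem_sdiff.1 (h₁.subset S hS hvS)).2 (mem_desc.2 (.refl v))
    · exact h.not_mem_desc hvS hvr (mem_inter.1 (h₂.subset S hS h.1)).2
  rw [bStat, graft, filter_insert, h.isTubeRoot_iff, filter_union]
  have hc : (τ₁.filter (t.IsTubeRoot u) ∪ τ₂.filter (t.IsTubeRoot u)).card =
      t.bStat u τ₁ + t.bStat u τ₂ :=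
    card_union_of_disjoint (hd.mono (filter_subset _ _) (filter_subset _ _))
  split_ifs
  · rw [card_insert_of_notMem, hc, add_comm]
    rw [← filter_union]
    exact fun hm => hS (mem_filter.1 hm).1
  · rw [hc, zero_add]

variable {K : Type*} [CommRing K]

/-- The factor `c_{b(v, τ) - 1, d(v)}` of a vertex. -/
def vertexFactor (t : DecTree D V) (c : ℕ → D → K) (τ : Finset (Finset V)) (v : V) : K :=
  c (t.bStat v τ - 1) (t.dec v)

/-- The linear coefficient of the polynomial attached to the tube `S`. -/
def linCoeff (t : DecTree D V) (c : ℕ → D → K) (S : Finset V) : K :=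
  ∑ τ ∈ t.tubingsOf S, ∏ v ∈ S, t.vertexFactor c τ v

variable [Algebra ℚ K]

/-- The generating polynomial `∑ c(τ) L ^ (b - 1) / (b - 1)!` of the binary tubings of a tube
`S` with root `r`. -/
def rootSum (t : DecTree D V) (c : ℕ → D → K) (S : Finset V) (r : V) : K[X] :=
  ∑ τ ∈ t.tubingsOf S, C (∏ v ∈ S.erase r, t.vertexFactor c τ v) *
    (C (invFac K (t.bStat r τ - 1)) * X ^ (t.bStat r τ - 1))

omit [Fintype V] [DecidableEq V] in
theorem bStat_singleton (r : V) : t.bStat r {{r}} = 1 := by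
  classical
  rw [bStat, filter_singleton, if_pos, card_singleton]
  exact ⟨mem_singleton_self r, fun u hu => by rw [mem_singleton.1 hu]; exact Below.refl r⟩

theorem rootSum_singleton (c : ℕ → D → K) (r : V) : t.rootSum c {r} r = 1 := by
  simp [rootSum, tubingsOf_singleton, bStat_singleton, invFac_zero]

theorem Lam_C_mul (c : ℕ → K) (a : K) (p : K[X]) : Lam c (C a * p) = C a * Lam c p := by
  rw [← smul_eq_C_mul, ← lamLin_apply, map_smul, smul_eq_C_mul, lamLin_apply]

/-- The linear coefficient of Λ(L^{b-1}/(b-1)!) is c_{b-1}, precisely the root's factor missing from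
the product over the other vertices. -/
theorem IsRootedTube.coeff_one_Lam_rootSum (h : t.IsRootedTube r S) (c : ℕ → D → K) :
    (Lam (fun n => c n (t.dec r)) (t.rootSum c S r)).coeff 1 = t.linCoeff c S := by
  rw [rootSum, ← lamLin_apply, map_sum, finsetSum_coeff, linCoeff]
  refine sum_congr rfl fun τ _ => ?_
  rw [lamLin_apply, Lam_C_mul, coeff_C_mul, coeff_one_Lam_divided_pow, ← prod_erase_mul S _ h.1]
  rfl

/-- The derivative of `rootSum` is a sum over all ways to cut an edge. -/
theorem IsRootedTube.derivative_rootSum (h : t.IsRootedTube r S) (c : ℕ → D → K) :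
    derivative (t.rootSum c S r) = ∑ v ∈ S.erase r,
      C (t.linCoeff c (S ∩ t.desc v)) * t.rootSum c (S \ t.desc v) r := by
  rcases le_or_gt S.card 1 with hS | hS
  · rw [h.eq_singleton hS, rootSum_singleton]
    simp
  rw [rootSum, h.sum_tubingsOf hS, derivative_sum]
  refine sum_congr rfl fun v hv => ?_
  obtain ⟨hvr, hvS⟩ := mem_erase.1 hv
  have hrd := h.not_mem_desc hvS hvr
  rw [rootSum, mul_sum, derivative_sum]
  refine sum_congr rfl fun τ₁ hτ₁ => ?_
  rw [linCoeff, map_sum C, sum_mul, derivative_sum]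
  refine sum_congr rfl fun τ₂ hτ₂ => ?_
  rw [mem_tubingsOf] at hτ₁ hτ₂
  -- The truncated subtractions are harmless, since the upper part itself is a tube of τ₁ with root
  -- r.
  have hb : t.bStat r (graft S τ₁ τ₂) - 1 = (t.bStat r τ₁ - 1) + 1 := by
    have := hτ₁.bStat_root_pos (h.sdiff_desc hvS hvr)
    rw [h.bStat_graft hv hτ₁ hτ₂, hτ₂.bStat_eq_zero (fun hm => hrd (mem_inter.1 hm).2),
      if_pos rfl]
    omega
  have hset : S.erase r = (S \ t.desc v).erase r ∪ (S ∩ t.desc v) := by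
    ext u
    simp only [mem_erase, mem_union, mem_sdiff, mem_inter]
    constructor
    · rintro ⟨h1, h2⟩
      by_cases hu : u ∈ t.desc v
      · exact .inr ⟨h2, hu⟩
      · exact .inl ⟨h1, h2, hu⟩
    · rintro (⟨h1, h2, -⟩ | ⟨h2, hu⟩)
      · exact ⟨h1, h2⟩
      · exact ⟨fun he => hrd (he ▸ hu), h2⟩
  have hdis : Disjoint ((S \ t.desc v).erase r) (S ∩ t.desc v) := by
    rw [disjoint_left]
    intro u hu hu'
    exact (mem_sdiff.1 (mem_of_mem_erase hu)).2 (mem_inter.1 hu').2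
  have hprod : ∏ u ∈ S.erase r, t.vertexFactor c (graft S τ₁ τ₂) u =
      (∏ u ∈ (S \ t.desc v).erase r, t.vertexFactor c τ₁ u) *
        ∏ u ∈ S ∩ t.desc v, t.vertexFactor c τ₂ u := by
    rw [hset, prod_union hdis]
    congr 1
    · refine prod_congr rfl fun u hu => ?_
      obtain ⟨hur, hu⟩ := mem_erase.1 hu
      rw [vertexFactor, h.bStat_graft hv hτ₁ hτ₂, if_neg hur,
        hτ₂.bStat_eq_zero (fun hm => (mem_sdiff.1 hu).2 (mem_inter.1 hm).2), zero_add, add_zero]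
      rfl
    · refine prod_congr rfl fun u hu => ?_
      rw [vertexFactor, h.bStat_graft hv hτ₁ hτ₂,
        if_neg (fun he : u = r => hrd (he ▸ (mem_inter.1 hu).2)),
        hτ₁.bStat_eq_zero (fun hm => (mem_sdiff.1 hm).2 (mem_inter.1 hu).2), zero_add, zero_add]
      rfl
  rw [hb, hprod, derivative_C_mul, derivative_divided_pow, C_mul]
  ring

/-- When S is a branch of a larger tube, the constant term accounts for cutting the edge above r,
and the sum for cutting an edge inside the branch. -/
theorem IsRootedTube.derivative_Lam_rootSum (h : t.IsRootedTube r S) (c : ℕ → D → K) :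
    derivative (Lam (fun n => c n (t.dec r)) (t.rootSum c S r)) =
      C (t.linCoeff c S) + ∑ v ∈ S.erase r, C (t.linCoeff c (S ∩ t.desc v)) *
        Lam (fun n => c n (t.dec r)) (t.rootSum c (S \ t.desc v) r) := by
  rw [derivative_Lam, h.coeff_one_Lam_rootSum, h.derivative_rootSum, ← lamLin_apply _ (Finset.sum _ _),
    map_sum]
  simp only [lamLin_apply, Lam_C_mul]

/-- Both S and the upper half of its partition are tubes with root r, so b - 1 is positive for every
tubing. -/
theorem IsRootedTube.coeff_zero_rootSum (h : t.IsRootedTube r S) (hS : 1 < S.card)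
    (c : ℕ → D → K) : (t.rootSum c S r).coeff 0 = 0 := by
  rw [rootSum, h.sum_tubingsOf hS, finsetSum_coeff]
  refine sum_eq_zero fun v hv => ?_
  rw [finsetSum_coeff]
  refine sum_eq_zero fun τ₁ hτ₁ => ?_
  rw [finsetSum_coeff]
  refine sum_eq_zero fun τ₂ hτ₂ => ?_
  rw [mem_tubingsOf] at hτ₁ hτ₂
  obtain ⟨hvr, hvS⟩ := mem_erase.1 hv
  have := hτ₁.bStat_root_pos (h.sdiff_desc hvS hvr)
  have hb : 0 ≠ t.bStat r (graft S τ₁ τ₂) - 1 := by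
    rw [h.bStat_graft hv hτ₁ hτ₂, if_pos rfl]
    omega
  rw [coeff_C_mul, coeff_C_mul_X_pow, if_neg hb, mul_zero]

end TubingStatistics

/-! ### Factorization over the children of the root. -/

section Children

variable {D V : Type*} [Fintype V] [DecidableEq V]

open scoped Classical in
/-- The set of children of `v`. -/
def children (t : DecTree D V) (v : V) : Finset V := univ.filter fun u => t.IsChild u v

variable {t : DecTree D V} {r u v w : V} {S : Finset V}

omit [DecidableEq V] in
@[simp] theorem mem_children : u ∈ t.children v ↔ t.IsChild u v := by simp [children]

@[to_additive]
theorem IsRootedTube.prod_erase_root {M : Type*} [CommMonoid M] (h : t.IsRootedTube r S)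
    (f : V → M) :
    ∏ v ∈ S.erase r, f v = ∏ w ∈ S ∩ t.children r, ∏ v ∈ S ∩ t.desc w, f v := by
  rw [← prod_biUnion]
  · refine prod_congr ?_ fun _ _ => rfl
    ext u
    simp only [mem_erase, mem_biUnion, mem_inter, mem_children, mem_desc]
    constructor
    · rintro ⟨hur, hu⟩
      obtain ⟨w, hw, huw⟩ := (h.below hu).exists_child hur
      exact ⟨w, ⟨h.mem_of_below hu huw hw.below, hw⟩, hu, huw⟩
    · rintro ⟨w, ⟨-, hw⟩, hu, huw⟩
      refine ⟨?_, hu⟩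
      rintro rfl
      exact hw.ne (hw.below.antisymm huw)
  · intro w hw w' hw' hne
    simp only [coe_inter, Set.mem_inter_iff, mem_coe, mem_children] at hw hw'
    rw [Function.onFun, disjoint_left]
    intro x hx hx'
    exact hne (hw.2.eq_of_below_of_below hw'.2 (mem_desc.1 (mem_inter.1 hx).2)
      (mem_desc.1 (mem_inter.1 hx').2))

@[to_additive]
theorem prod_desc {M : Type*} [CommMonoid M] (t : DecTree D V) (f : V → M) (u : V) :
    ∏ v ∈ t.desc u, f v = f u * ∏ w ∈ t.children u, ∏ v ∈ t.desc w, f v := by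
  have h := isRootedTube_desc (t := t) u
  rw [← mul_prod_erase _ _ h.1, h.prod_erase_root]
  congr 1
  refine prod_congr (inter_eq_right.2 fun w hw => mem_desc.2 (mem_children.1 hw).below)
    fun w hw => prod_congr (inter_eq_right.2 fun x hx => ?_) fun _ _ => rfl
  exact mem_desc.2 ((mem_desc.1 hx).trans (mem_children.1 hw).below)

variable {K : Type*} [CommRing K] [Algebra ℚ K]

/-- The generating polynomial of the binary tubings of a tube is a product over the children of
its root. -/
theorem IsRootedTube.rootSum_eq_prod (h : t.IsRootedTube r S) (c : ℕ → D → K) :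
    t.rootSum c S r = ∏ w ∈ S ∩ t.children r,
      Lam (fun n => c n (t.dec w)) (t.rootSum c (S ∩ t.desc w) w) := by
  induction hn : S.card using Nat.strong_induction_on generalizing S with
  | _ n ih =>
  subst hn
  rcases le_or_gt S.card 1 with hS | hS
  · obtain rfl := h.eq_singleton hS
    have : ({r} : Finset V) ∩ t.children r = ∅ := by
      rw [singleton_inter_of_notMem]
      exact fun hr => (mem_children.1 hr).ne rfl
    rw [this, rootSum_singleton, prod_empty]
  -- By the Leibniz rule, differentiating the factor of a child w must match the cuts at vertices of
  -- the branch at w.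
  refine eq_of_derivative_eq_of_coeff_zero_eq ?_ ?_
  · rw [h.derivative_rootSum, h.sum_erase_root, derivative_prod_finset]
    refine sum_congr rfl fun w hw => ?_
    obtain ⟨hwS, hwr⟩ := mem_inter.1 hw
    rw [mem_children] at hwr
    have hT := h.inter_desc hwS
    have hother : ∀ v ∈ S ∩ t.desc w, ∀ w' ∈ (S ∩ t.children r).erase w,
        (S \ t.desc v) ∩ t.desc w' = S ∩ t.desc w' := by
      intro v hv w' hw'
      obtain ⟨hne, hw'⟩ := mem_erase.1 hw'
      ext x
      simp only [mem_inter, mem_sdiff, mem_desc]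
      constructor
      · exact fun hx => ⟨hx.1.1, hx.2⟩
      · exact fun hx => ⟨⟨hx.1, fun hxv => hne
          ((mem_children.1 (mem_inter.1 hw').2).eq_of_below_of_below hwr hx.2
            (hxv.trans (mem_desc.1 (mem_inter.1 hv).2)))⟩, hx.2⟩
    have hcut : ∀ v ∈ S ∩ t.desc w, t.IsRootedTube r (S \ t.desc v) ∧
        (S \ t.desc v).card < S.card := by
      intro v hv
      obtain ⟨hvS, hvw⟩ := mem_inter.1 hv
      have hvr : v ≠ r := by
        rintro rfl
        exact hwr.ne (hwr.below.antisymm (mem_desc.1 hvw))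
      refine ⟨h.sdiff_desc hvS hvr, card_lt_card ⟨sdiff_subset, fun hs => ?_⟩⟩
      exact (mem_sdiff.1 (hs hvS)).2 (mem_desc.2 (.refl v))
    -- Cutting the edge above w removes its factor altogether.
    have hcut_root : t.rootSum c (S \ t.desc w) r = ∏ w' ∈ (S ∩ t.children r).erase w,
        Lam (fun n => c n (t.dec w')) (t.rootSum c (S ∩ t.desc w') w') := by
      obtain ⟨hR, hlt⟩ := hcut w hT.1
      rw [ih _ hlt hR rfl]
      have hset : (S \ t.desc w) ∩ t.children r = (S ∩ t.children r).erase w := by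
        ext x
        simp only [mem_inter, mem_sdiff, mem_desc, mem_children, mem_erase]
        constructor
        · rintro ⟨⟨hx, hxw⟩, hxr⟩
          exact ⟨fun he => hxw (he ▸ .refl x), hx, hxr⟩
        · rintro ⟨hne, hx, hxr⟩
          exact ⟨⟨hx, fun hxw => hne (hxr.eq_of_below hwr hxw)⟩, hxr⟩
      rw [hset]
      exact prod_congr rfl fun w' hw' => by rw [hother w hT.1 w' hw']
    -- Cutting strictly inside the branch at w keeps all factors and only shrinks the tube in the
    -- factor of w.
    have hcut_inner : ∀ v ∈ (S ∩ t.desc w).erase w, t.rootSum c (S \ t.desc v) r =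
        (∏ w' ∈ (S ∩ t.children r).erase w,
          Lam (fun n => c n (t.dec w')) (t.rootSum c (S ∩ t.desc w') w')) *
        Lam (fun n => c n (t.dec w)) (t.rootSum c ((S ∩ t.desc w) \ t.desc v) w) := by
      intro v hv
      obtain ⟨hvw, hv⟩ := mem_erase.1 hv
      obtain ⟨hR, hlt⟩ := hcut v hv
      have hvb := mem_desc.1 (mem_inter.1 hv).2
      rw [ih _ hlt hR rfl]
      have hset : (S \ t.desc v) ∩ t.children r = S ∩ t.children r := by
        ext x
        simp only [mem_inter, mem_sdiff, mem_desc, mem_children]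
        constructor
        · exact fun hx => ⟨hx.1.1, hx.2⟩
        · rintro ⟨hx, hxr⟩
          refine ⟨⟨hx, fun hxv => hvw ?_⟩, hxr⟩
          obtain rfl := hxr.eq_of_below hwr (hxv.trans hvb)
          exact hvb.antisymm hxv
      rw [hset, ← prod_erase_mul _ _ hw]
      congr 1
      · exact prod_congr rfl fun w' hw' => by rw [hother v hv w' hw']
      · rw [show (S \ t.desc v) ∩ t.desc w = (S ∩ t.desc w) \ t.desc v from sdiff_inter_right_comm _ _ _]
    rw [hT.derivative_Lam_rootSum, ← add_sum_erase _ _ hT.1, mul_add, mul_sum, hcut_root,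
      mul_comm (C _)]
    refine congrArg _ (sum_congr rfl fun v hv => ?_)
    have hvd : (S ∩ t.desc w) ∩ t.desc v = S ∩ t.desc v := by
      rw [inter_assoc]
      congr 1
      refine inter_eq_right.2 fun x hx => mem_desc.2 ((mem_desc.1 hx).trans ?_)
      exact mem_desc.1 (mem_inter.1 (mem_of_mem_erase hv)).2
    rw [hcut_inner v hv, hvd, mul_left_comm]
  -- The product has at least one factor, and every value of Λ has zero constant term.
  · have hne : (S ∩ t.children r).Nonempty := by
      obtain ⟨u, hu, hur⟩ := exists_mem_ne hS r
      obtain ⟨w, hw, huw⟩ := (h.below hu).exists_child hur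
      exact ⟨w, mem_inter.2 ⟨h.mem_of_below hu huw hw.below, mem_children.2 hw⟩⟩
    obtain ⟨w, hw⟩ := hne
    rw [h.coeff_zero_rootSum hS, ← mul_prod_erase _ _ hw, mul_coeff_zero, coeff_zero_Lam, zero_mul]

/-- The polynomial attached to the subtree at `u`. -/
def subtreeSum (t : DecTree D V) (c : ℕ → D → K) (u : V) : K[X] :=
  Lam (fun n => c n (t.dec u)) (t.rootSum c (t.desc u) u)

/-- This recursion no longer mentions tubings; it is all that the comparison with the system needs.
-/
theorem subtreeSum_eq (c : ℕ → D → K) (u : V) :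
    t.subtreeSum c u =
      Lam (fun n => c n (t.dec u)) (∏ w ∈ t.children u, t.subtreeSum c w) := by
  rw [subtreeSum, (isRootedTube_desc u).rootSum_eq_prod]
  congr 1
  have hset : t.desc u ∩ t.children u = t.children u :=
    inter_eq_right.2 fun w hw => mem_desc.2 (mem_children.1 hw).below
  rw [hset]
  refine prod_congr rfl fun w hw => ?_
  rw [subtreeSum]
  congr 2
  exact inter_eq_right.2 fun x hx =>
    mem_desc.2 ((mem_desc.1 hx).trans (mem_children.1 hw).below)

end Children

end DecTree

/-- The inner sum over i is Λ(L^{b-1}/(b-1)!), with i = j + 1. -/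
theorem tubingSum_eq_subtreeSum {A V K : Type*} [Fintype V] [DecidableEq V] [CommRing K]
    [Algebra ℚ K] (c : ℕ → A × ℕ+ → K) (t : DecTree (A × ℕ+) V) :
    tubingSum c t = t.subtreeSum c t.root := by
  rw [tubingSum, DecTree.subtreeSum, DecTree.desc_root, DecTree.rootSum, ← lamLin_apply, map_sum,
    DecTree.tubings_eq_tubingsOf]
  refine sum_congr rfl fun τ hτ => ?_
  rw [lamLin_apply, DecTree.Lam_C_mul]
  congr 1
  have hR : t.IsRootedTube t.root univ := DecTree.desc_root (t := t) ▸ DecTree.isRootedTube_desc _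
  have hpos := (DecTree.mem_tubingsOf.1 hτ).bStat_root_pos hR
  rw [Lam_divided_pow, DecTree.bRoot, Nat.sub_add_cancel hpos, ← Finset.Ico_add_one_right_eq_Icc,
    sum_Ico_eq_sum_range, Nat.add_sub_cancel]
  refine sum_congr rfl fun j _ => ?_
  rw [invFac, Nat.sub_sub, add_comm 1 j]

namespace DecTree

/-! ### Isomorphisms as maps that are bijective on children. -/

section Coverings

variable {D V W : Type*}

/-- A map of trees onto the descendants of `u`, which is bijective on children. -/
structure IsCov (t' : DecTree D W) (t : DecTree D V) (u : V) (g : W → V) : Prop where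
  root : g t'.root = u
  dec : ∀ x, t.dec (g x) = t'.dec x
  bijOn : ∀ x, Set.BijOn g {y | t'.IsChild y x} {y | t.IsChild y (g x)}

variable {t' : DecTree D W} {t : DecTree D V} {g : W → V}

theorem IsCov.apply_parent {u : V} (h : IsCov t' t u g) {x : W} (hx : x ≠ t'.root) :
    t.IsChild (g x) (g (t'.parent x)) :=
  (h.bijOn (t'.parent x)).mapsTo ⟨hx, rfl⟩

theorem IsCov.depth (h : IsCov t' t t.root g) (x : W) : t.depth (g x) = t'.depth x := by
  induction hn : t'.depth x using Nat.strong_induction_on generalizing x with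
  | _ n ih =>
    by_cases hx : x = t'.root
    · rw [← hn, hx, h.root, depth_eq_zero.2 rfl, depth_eq_zero.2 rfl]
    · have := depth_parent hx
      rw [(h.apply_parent hx).depth, ih _ (by omega) _ rfl]
      omega

/-- Depth is preserved, so induction on depth reduces both halves to the bijection between the
children of one vertex and those of its image. -/
theorem IsCov.bijective (h : IsCov t' t t.root g) : Function.Bijective g := by
  constructor
  · intro x y hxy
    induction hn : t'.depth x using Nat.strong_induction_on generalizing x y with
    | _ n ih =>
      have hd : t'.depth x = t'.depth y := by rw [← h.depth, ← h.depth, hxy]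
      by_cases hx : x = t'.root
      · have : t'.depth x = 0 := depth_eq_zero.2 hx
        rw [hx, depth_eq_zero.1 (hd.symm.trans this)]
      · have hy : y ≠ t'.root := fun hy => hx (depth_eq_zero.1 (hd.trans (depth_eq_zero.2 hy)))
        have h1 := (h.apply_parent hx).2
        have h2 := (h.apply_parent hy).2
        have := depth_parent hx
        have hp := ih _ (by omega) (h1.symm.trans (hxy ▸ h2)) rfl
        exact (h.bijOn (t'.parent x)).injOn ⟨hx, rfl⟩ ⟨hy, hp.symm⟩ hxy
  · intro v
    induction hn : t.depth v using Nat.strong_induction_on generalizing v with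
    | _ n ih =>
      by_cases hv : v = t.root
      · exact ⟨t'.root, by rw [h.root, hv]⟩
      · have := depth_parent hv
        obtain ⟨x, hx⟩ := ih _ (by omega) (t.parent v) rfl
        obtain ⟨y, -, hy⟩ := (h.bijOn x).surjOn ⟨hv, hx.symm⟩
        exact ⟨y, hy⟩

/-- A graph isomorphism knows only adjacency; fixing the root orients the edges. Were an edge
reversed, induction on depth would make x its own grandparent. -/
theorem Iso.apply_parent (f : Iso t' t) {x : W} (hx : x ≠ t'.root) :
    t.IsChild (f.1 x) (f.1 (t'.parent x)) := by
  have hne : ∀ {y}, y ≠ t'.root → f.1 y ≠ t.root := fun hy he =>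
    hy (f.1.injective (he.trans f.2.1.symm))
  refine ⟨hne hx, ?_⟩
  induction hn : t'.depth x using Nat.strong_induction_on generalizing x with
  | _ n ih =>
    have hadj := f.1.map_adj_iff.2 (graph_adj_parent hx)
    refine (graph_adj_iff.1 hadj).2.resolve_right fun h => ?_
    by_cases hp : t'.parent x = t'.root
    · rw [hp, f.2.1, t.parent_root] at h
      exact hne hx h.symm
    · have := depth_parent hx
      rw [ih _ (by omega) hp rfl] at h
      have h1 := f.1.injective h
      have h2 := depth_parent hp
      rw [h1] at h2
      omega

theorem Iso.isCov (f : Iso t' t) : IsCov t' t t.root f.1 := by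
  refine ⟨f.2.1, f.2.2, fun x => ⟨?_, f.1.injective.injOn, ?_⟩⟩
  · rintro y ⟨hy, rfl⟩
    exact f.apply_parent hy
  · rintro v ⟨hv, hp⟩
    obtain ⟨y, rfl⟩ := f.1.surjective v
    have hy : y ≠ t'.root := fun he => hv (he ▸ f.2.1)
    exact ⟨y, ⟨hy, f.1.injective ((f.apply_parent hy).2.symm.trans hp)⟩, rfl⟩

theorem IsCov.exists_iso (h : IsCov t' t t.root g) : ∃ f : Iso t' t, ⇑f.1 = g := by
  have hroot : ∀ x, g x = t.root ↔ x = t'.root := fun x =>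
    ⟨fun hx => h.bijective.1 (hx.trans h.root.symm), fun hx => hx ▸ h.root⟩
  have hpar : ∀ x y, t.parent (g x) = g y ↔ t'.parent x = y := by
    intro x y
    by_cases hx : x = t'.root
    · rw [hx, h.root, t.parent_root, t'.parent_root, eq_comm, hroot, eq_comm]
    · rw [(h.apply_parent hx).2, h.bijective.1.eq_iff]
  refine ⟨⟨⟨Equiv.ofBijective g h.bijective, ?_⟩, h.root, h.dec⟩, rfl⟩
  intro x y
  change t.graph.Adj (g x) (g y) ↔ _
  rw [graph_adj_iff, graph_adj_iff, hpar, hpar, h.bijective.1.ne_iff]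

theorem card_cov_eq_card_iso (t' : DecTree D W) (t : DecTree D V) :
    Nat.card {g // IsCov t' t t.root g} = Nat.card (Iso t' t) := by
  symm
  refine Nat.card_eq_of_bijective (fun f : Iso t' t => ⟨f.1, f.isCov⟩) ⟨fun f f' h => ?_, ?_⟩
  · exact Subtype.ext (DFunLike.coe_injective (congrArg Subtype.val h))
  · rintro ⟨g, hg⟩
    obtain ⟨f, rfl⟩ := hg.exists_iso
    exact ⟨f, rfl⟩

/-- Composition of isomorphisms of decorated rooted trees. -/
def Iso.trans {U : Type*} {t'' : DecTree D U} (f : Iso t'' t') (f' : Iso t' t) : Iso t'' t :=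
  ⟨f.1.trans f'.1, (congrArg f'.1 f.2.1).trans f'.2.1,
    fun v => (f'.2.2 (f.1 v)).trans (f.2.2 v)⟩

/-- The inverse of an isomorphism of decorated rooted trees. -/
def Iso.symm (f : Iso t' t) : Iso t t' :=
  ⟨f.1.symm, (congrArg f.1.symm f.2.1.symm).trans (f.1.symm_apply_apply _),
    fun v => (f.2.2 (f.1.symm v)).symm.trans (congrArg _ (f.1.apply_symm_apply v))⟩

theorem card_iso_eq_card_aut (e : Iso t' t) : Nat.card (Iso t' t) = Nat.card t.Aut := by
  refine Nat.card_congr ⟨fun f => e.symm.trans f, fun f => e.trans f, fun f => ?_, fun f => ?_⟩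
  · refine Subtype.ext (RelIso.ext fun x => ?_)
    exact congrArg f.1 (e.1.symm_apply_apply x)
  · refine Subtype.ext (RelIso.ext fun x => ?_)
    exact congrArg f.1 (e.1.apply_symm_apply x)

end Coverings

/-! ### Joining trees at a new root. -/

section Join

variable {D : Type*} {ι : Type*} {W : ι → Type*}

open scoped Classical in
/-- The tree obtained by joining trees to a new root with decoration `d`. -/
def join (d : D) (ts : ∀ i, DecTree D (W i)) : DecTree D (Option (Σ i, W i)) where
  root := none
  parent x := x.elim none fun y =>
    if y.2 = (ts y.1).root then none else some ⟨y.1, (ts y.1).parent y.2⟩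
  parent_root := rfl
  reaches_root := by
    rintro (_ | ⟨i, v⟩)
    · exact ⟨0, rfl⟩
    · obtain ⟨n, hn⟩ := (ts i).reaches_root v
      induction n generalizing v with
      | zero => exact ⟨1, if_pos hn⟩
      | succ n ih =>
        by_cases hv : v = (ts i).root
        · exact ⟨1, if_pos hv⟩
        · obtain ⟨m, hm⟩ := ih ((ts i).parent v) hn
          refine ⟨m + 1, ?_⟩
          rw [Function.iterate_succ_apply]
          refine (congrArg _ ?_).trans hm
          exact if_neg hv
  dec x := x.elim d fun y => (ts y.1).dec y.2

variable {d : D} {ts : ∀ i, DecTree D (W i)}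

theorem join_isChild_none {y : Option (Σ i, W i)} :
    (join d ts).IsChild y none ↔ ∃ i, some ⟨i, (ts i).root⟩ = y := by
  constructor
  · rintro ⟨h1, h2⟩
    rcases y with _ | ⟨i, v⟩
    · exact absurd rfl h1
    · refine ⟨i, ?_⟩
      by_cases hv : v = (ts i).root
      · rw [hv]
      · exact absurd ((if_neg hv).symm.trans h2) (by simp)
  · rintro ⟨i, rfl⟩
    exact ⟨Option.some_ne_none _, if_pos rfl⟩

theorem join_isChild_some {y : Option (Σ i, W i)} {i : ι} {v : W i} :
    (join d ts).IsChild y (some ⟨i, v⟩) ↔ ∃ w, (ts i).IsChild w v ∧ some ⟨i, w⟩ = y := by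
  constructor
  · rintro ⟨h1, h2⟩
    rcases y with _ | ⟨j, w⟩
    · exact absurd rfl h1
    · by_cases hw : w = (ts j).root
      · exact absurd ((if_pos hw).symm.trans h2) (by simp)
      · have h3 := Option.some_injective _ ((if_neg hw).symm.trans h2)
        cases h3
        exact ⟨w, ⟨hw, rfl⟩, rfl⟩
  · rintro ⟨w, ⟨h1, rfl⟩, rfl⟩
    exact ⟨Option.some_ne_none _, if_neg h1⟩

variable {V : Type*} {t : DecTree D V} {u : V} {g : Option (Σ i, W i) → V}

theorem isCov_join_iff : IsCov (join d ts) t u g ↔ g none = u ∧ t.dec u = d ∧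
    Set.BijOn (fun i => g (some ⟨i, (ts i).root⟩)) Set.univ {y | t.IsChild y u} ∧
    ∀ i, IsCov (ts i) t (g (some ⟨i, (ts i).root⟩)) fun v => g (some ⟨i, v⟩) := by
  have hnone : {y | (join d ts).IsChild y none} = Set.range fun i => some ⟨i, (ts i).root⟩ := by
    ext y; exact join_isChild_none
  have hsome : ∀ i v, {y | (join d ts).IsChild y (some ⟨i, v⟩)} =
      (fun w => some ⟨i, w⟩) '' {w | (ts i).IsChild w v} := by
    intro i v; ext y; exact join_isChild_some
  have inj1 : Function.Injective fun i : ι => (some ⟨i, (ts i).root⟩ : Option (Σ i, W i)) := by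
    intro i j h
    cases h
    rfl
  have inj2 : ∀ i, Function.Injective fun w : W i => (some ⟨i, w⟩ : Option (Σ i, W i)) := by
    intro i v w h
    cases h
    rfl
  have bij1 : Set.BijOn g {y | (join d ts).IsChild y none} {y | t.IsChild y (g none)} ↔
      Set.BijOn (fun i => g (some ⟨i, (ts i).root⟩)) Set.univ {y | t.IsChild y (g none)} := by
    rw [hnone, ← Set.image_univ]
    exact (Set.bijOn_comp_iff inj1.injOn).symm
  have bij2 : ∀ i v, Set.BijOn g {y | (join d ts).IsChild y (some ⟨i, v⟩)}
      {y | t.IsChild y (g (some ⟨i, v⟩))} ↔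
      Set.BijOn (fun w => g (some ⟨i, w⟩)) {w | (ts i).IsChild w v}
        {y | t.IsChild y (g (some ⟨i, v⟩))} := by
    intro i v
    rw [hsome]
    exact (Set.bijOn_comp_iff (inj2 i).injOn).symm
  constructor
  · intro h
    obtain rfl := h.root
    exact ⟨rfl, h.dec none, bij1.1 (h.bijOn none),
      fun i => ⟨rfl, fun v => h.dec (some ⟨i, v⟩), fun v => (bij2 i v).1 (h.bijOn _)⟩⟩
  · rintro ⟨rfl, h1, h2, h3⟩
    refine ⟨rfl, ?_, ?_⟩
    · rintro (_ | ⟨i, v⟩)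
      exacts [h1, (h3 i).dec v]
    · rintro (_ | ⟨i, v⟩)
      exacts [bij1.2 h2, (bij2 i v).2 ((h3 i).bijOn v)]

/-- A covering is a matching σ of the joined trees with the children of u, together with independent
coverings of the branches so matched. -/
theorem card_cov_join [Finite V] [Fintype ι] [∀ i, Finite (W i)] [Fintype (ι ≃ {y // t.IsChild y u})]
    (hd : t.dec u = d) :
    Nat.card {g // IsCov (join d ts) t u g} =
      ∑ σ : ι ≃ {y // t.IsChild y u}, ∏ i, Nat.card {h // IsCov (ts i) t (σ i) h} := by
  have : ∀ σ : ι ≃ {y // t.IsChild y u}, ∏ i, Nat.card {h // IsCov (ts i) t (σ i) h} =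
      Nat.card (∀ i, {h // IsCov (ts i) t (σ i) h}) := fun σ => (Nat.card_pi).symm
  simp_rw [this]
  rw [← Nat.card_sigma]
  symm
  let glue (x : Σ σ : ι ≃ {y // t.IsChild y u}, ∀ i, {h // IsCov (ts i) t (σ i) h}) :
      Option (Σ i, W i) → V := fun y => y.elim u fun z => (x.2 z.1).1 z.2
  have hglue : ∀ x, IsCov (join d ts) t u (glue x) := by
    rintro ⟨σ, h⟩
    have hr : ∀ i, (h i).1 (ts i).root = σ i := fun i => (h i).2.root
    refine isCov_join_iff.2 ⟨rfl, hd, ?_, fun i => ?_⟩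
    · change Set.BijOn (fun i => (h i).1 (ts i).root) _ _
      simp_rw [hr]
      refine ⟨fun i _ => (σ i).2, fun i _ j _ hij => σ.injective (Subtype.ext hij), fun y hy => ?_⟩
      exact ⟨σ.symm ⟨y, hy⟩, trivial, by simp⟩
    · change IsCov (ts i) t ((h i).1 (ts i).root) (h i).1
      rw [hr]
      exact (h i).2
  refine Nat.card_eq_of_bijective (fun x => ⟨glue x, hglue x⟩) ⟨?_, ?_⟩
  · rintro ⟨σ, h⟩ ⟨σ', h'⟩ he
    have he' : ∀ i v, (h i).1 v = (h' i).1 v := fun i v =>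
      congrFun (congrArg Subtype.val he) (some ⟨i, v⟩)
    obtain rfl : σ = σ' := by
      ext i
      rw [← (h i).2.root, ← (h' i).2.root, he']
    congr 1
    funext i
    exact Subtype.ext (funext (he' i))
  · rintro ⟨g, hg⟩
    obtain ⟨h0, -, h1, h2⟩ := isCov_join_iff.1 hg
    refine ⟨⟨Equiv.ofBijective (fun i => ⟨g (some ⟨i, (ts i).root⟩), h1.mapsTo trivial⟩) ⟨?_, ?_⟩,
      fun i => ⟨fun v => g (some ⟨i, v⟩), h2 i⟩⟩, ?_⟩
    · intro i j hij
      exact h1.injOn trivial trivial (congrArg Subtype.val hij)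
    · rintro ⟨y, hy⟩
      obtain ⟨i, -, hi⟩ := h1.surjOn hy
      exact ⟨i, Subtype.ext hi⟩
    · refine Subtype.ext (funext ?_)
      rintro (_ | ⟨i, v⟩)
      exacts [h0.symm, rfl]

end Join

end DecTree

/-- Plane trees with decorated vertices. -/
inductive PlaneTree (D : Type*) : Type _
  | node (d : D) (m : ℕ) (ts : Fin m → PlaneTree D) : PlaneTree D

namespace PlaneTree

/-! ### Plane embeddings and the order of the automorphism group. -/

section Realization

variable {D : Type*}

/-- The vertices of a plane tree. -/
def Vert : PlaneTree D → Type
  | node _ _ ts => Option (Σ i, (ts i).Vert)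

instance finite_vert (p : PlaneTree D) : Finite p.Vert := by
  induction p with
  | node d m ts ih => exact inferInstanceAs (Finite (Option (Σ i, (ts i).Vert)))

/-- The rooted tree underlying a plane tree. -/
def toDecTree : (p : PlaneTree D) → DecTree D p.Vert
  | node d _ ts => DecTree.join d fun i => (ts i).toDecTree

/-- The decoration of the root. -/
def dec : PlaneTree D → D
  | node d _ _ => d

/-- The product of the inverse factorials of the numbers of children. -/
def mass : PlaneTree D → ℚ
  | node _ m ts => 1 / (m.factorial : ℚ) * ∏ i, (ts i).mass

variable {V : Type*}

/-- The plane tree `p` is a plane embedding of the subtree of `t` at `u`. -/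
def Embeds (p : PlaneTree D) (t : DecTree D V) (u : V) : Prop :=
  ∃ g, DecTree.IsCov p.toDecTree t u g

/-- The number of ways in which `p` is a plane embedding of the subtree of `t` at `u`. -/
def embeddings (p : PlaneTree D) (t : DecTree D V) (u : V) : ℕ :=
  Nat.card {g // DecTree.IsCov p.toDecTree t u g}

variable {t : DecTree D V} {u : V} {d : D} {m : ℕ} {ts : Fin m → PlaneTree D}

theorem embeddings_ne_zero [Finite V] {p : PlaneTree D} :
    p.embeddings t u ≠ 0 ↔ p.Embeds t u := by
  rw [embeddings, Nat.card_ne_zero, nonempty_subtype, and_iff_left (Subtype.finite)]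
  rfl

theorem embeds_node (h : (node d m ts).Embeds t u) :
    t.dec u = d ∧ ∃ σ : Fin m ≃ {y // t.IsChild y u}, ∀ i, (ts i).Embeds t (σ i) := by
  obtain ⟨g, hg⟩ := h
  obtain ⟨-, hd, hb, hi⟩ := DecTree.isCov_join_iff.1 hg
  refine ⟨hd, Equiv.ofBijective (fun i => ⟨_, hb.mapsTo (Set.mem_univ i)⟩) ⟨?_, ?_⟩,
    fun i => ⟨_, hi i⟩⟩
  · intro i j hij
    exact hb.injOn trivial trivial (congrArg Subtype.val hij)
  · rintro ⟨y, hy⟩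
    obtain ⟨i, -, hi⟩ := hb.surjOn hy
    exact ⟨i, Subtype.ext hi⟩

theorem Embeds.dec_eq {p : PlaneTree D} (h : p.Embeds t u) : t.dec u = p.dec := by
  cases p
  exact (embeds_node h).1

theorem embeddings_node [Finite V] [Fintype (Fin m ≃ {y // t.IsChild y u})] (h : t.dec u = d) :
    (node d m ts).embeddings t u =
      ∑ σ : Fin m ≃ {y // t.IsChild y u}, ∏ i, (ts i).embeddings t (σ i) :=
  DecTree.card_cov_join h

/-- Every tree has plane embeddings, and their total mass, counted with multiplicities, is `1`. -/
theorem exists_sum_mass_mul_embeddings [Finite V] (t : DecTree D V) (u : V) :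
    ∃ S : Finset (PlaneTree D), (∀ p, p.Embeds t u → p ∈ S) ∧
      ∑ p ∈ S, p.mass * p.embeddings t u = 1 := by
  classical
  have := Fintype.ofFinite V
  induction hn : (t.desc u).card using Nat.strong_induction_on generalizing u with
  | _ n ih =>
  have hchild : ∀ w : {y // t.IsChild y u}, ∃ S : Finset (PlaneTree D),
      (∀ p, p.Embeds t w → p ∈ S) ∧ ∑ p ∈ S, p.mass * p.embeddings t w = 1 := by
    rintro ⟨w, hw⟩
    refine ih _ ?_ w rfl
    rw [← hn]
    refine card_lt_card ⟨fun x hx => ?_, fun hs => ?_⟩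
    · exact DecTree.mem_desc.2 ((DecTree.mem_desc.1 hx).trans hw.below)
    · exact hw.ne (hw.below.antisymm (DecTree.mem_desc.1 (hs (DecTree.mem_desc.2 (.refl u)))))
  choose T hT hT1 using hchild
  -- One finite set serving all children at once; the added plane trees contribute zero embeddings.
  let S := univ.biUnion T
  have hS : ∀ (w : {y // t.IsChild y u}) p, Embeds p t w.1 → p ∈ S := fun w p h =>
    mem_biUnion.2 ⟨w, mem_univ w, hT w p h⟩
  have hS1 : ∀ w : {y // t.IsChild y u}, ∑ p ∈ S, p.mass * (p.embeddings t w : ℚ) = 1 := by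
    intro w
    rw [← hT1 w]
    symm
    refine sum_subset (subset_biUnion_of_mem T (mem_univ w)) fun p _ hp => ?_
    have : p.embeddings t w = 0 := by
      by_contra h0
      exact hp (hT w p (embeddings_ne_zero.1 h0))
    rw [this, Nat.cast_zero, mul_zero]
  set m := Fintype.card {y // t.IsChild y u} with hm
  refine ⟨(Fintype.piFinset fun _ : Fin m => S).image (node (t.dec u) m), ?_, ?_⟩
  · rintro ⟨d, m', ts⟩ h
    obtain ⟨rfl, σ, hσ⟩ := embeds_node h
    obtain rfl : m' = m := by rw [hm, ← Fintype.card_congr σ, Fintype.card_fin]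
    exact mem_image.2 ⟨ts, Fintype.mem_piFinset.2 fun i => hS _ _ (hσ i), rfl⟩
  · rw [sum_image fun _ _ _ _ h => by cases h; rfl]
    simp_rw [embeddings_node rfl, mass, Nat.cast_sum, Nat.cast_prod, mul_sum]
    rw [sum_comm]
    -- For fixed σ the sum factors over the branches, each factor being 1 by induction. The m!
    -- choices of σ then cancel the remaining 1/m!.
    have hσ : ∀ σ : Fin m ≃ {y // t.IsChild y u},
        ∑ ts ∈ Fintype.piFinset fun _ : Fin m => S, 1 / (m.factorial : ℚ) * (∏ i, (ts i).mass) *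
          ∏ i, ((ts i).embeddings t (σ i) : ℚ) = 1 / (m.factorial : ℚ) := by
      intro σ
      simp_rw [mul_assoc, ← prod_mul_distrib, ← mul_sum]
      rw [← prod_univ_sum (fun _ => S)
        (fun i (p : PlaneTree D) => p.mass * (p.embeddings t (σ i) : ℚ))]
      simp_rw [hS1, prod_const_one, mul_one]
    have e : Fin m ≃ {y // t.IsChild y u} := (Fintype.equivFin _).symm
    rw [sum_congr rfl fun σ _ => hσ σ, sum_const, card_univ, Fintype.card_equiv e,
      Fintype.card_fin, nsmul_eq_mul, mul_one_div_cancel]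
    exact_mod_cast m.factorial_ne_zero

theorem embeds_root_iff {p : PlaneTree D} :
    p.Embeds t t.root ↔ Nonempty (DecTree.Iso p.toDecTree t) := by
  constructor
  · rintro ⟨g, hg⟩
    obtain ⟨f, -⟩ := hg.exists_iso
    exact ⟨f⟩
  · rintro ⟨f⟩
    exact ⟨_, f.isCov⟩

/-- The total mass of the plane embeddings of a tree is the inverse of the order of its
automorphism group. -/
theorem sum_mass [Finite V] (t : DecTree D V) (S : Finset (PlaneTree D))
    (hS : ∀ p, p ∈ S ↔ p.Embeds t t.root) : ∑ p ∈ S, p.mass = 1 / (Nat.card t.Aut : ℚ) := by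
  classical
  obtain ⟨T, hT, hT1⟩ := exists_sum_mass_mul_embeddings t t.root
  have h1 : ∑ p ∈ S, p.mass * (p.embeddings t t.root : ℚ) = 1 := by
    rw [← hT1]
    refine sum_subset (fun p hp => hT p ((hS p).1 hp)) fun p _ hp => ?_
    have : p.embeddings t t.root = 0 := by
      by_contra h0
      exact hp ((hS p).2 (embeddings_ne_zero.1 h0))
    rw [this, Nat.cast_zero, mul_zero]
  -- Once a single isomorphism exists, composition with it identifies all isomorphisms with
  -- automorphisms.
  have h2 : ∀ p ∈ S, p.embeddings t t.root = Nat.card t.Aut := by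
    intro p hp
    obtain ⟨f⟩ := embeds_root_iff.1 ((hS p).1 hp)
    rw [embeddings, DecTree.card_cov_eq_card_iso, DecTree.card_iso_eq_card_aut f]
  rw [sum_congr rfl fun p hp => by rw [h2 p hp], ← sum_mul] at h1
  exact eq_one_div_of_mul_eq_one_left h1

end Realization

/-! ### Tubing sum, weight and ξ computed on plane trees. -/

section Functionals

variable {V : Type*} [Fintype V] [DecidableEq V]

omit [DecidableEq V] in
theorem prod_children {D M : Type*} [CommMonoid M] {t : DecTree D V} {u : V} {m : ℕ}
    (σ : Fin m ≃ {y // t.IsChild y u}) (f : V → M) :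
    ∏ w ∈ t.children u, f w = ∏ i, f (σ i) := by
  classical
  rw [σ.prod_comp fun w => f w]
  exact prod_subtype _ (fun w => DecTree.mem_children) f

variable {A K : Type*} [CommRing K] [Algebra ℚ K]

/-- The polynomial attached to a plane tree. -/
def poly {D : Type*} (c : ℕ → D → K) : PlaneTree D → K[X]
  | node d _ ts => Lam (fun n => c n d) (∏ i, (ts i).poly c)

theorem Embeds.subtreeSum_eq {D : Type*} (c : ℕ → D → K) {t : DecTree D V} {p : PlaneTree D} {u : V}
    (h : p.Embeds t u) : t.subtreeSum c u = p.poly c := by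
  induction p generalizing u with
  | node d m ts ih =>
    obtain ⟨rfl, σ, hσ⟩ := embeds_node h
    rw [DecTree.subtreeSum_eq, prod_children σ, poly]
    exact congrArg _ (prod_congr rfl fun i _ => ih i (hσ i))

/-- The total weight of a plane tree. -/
def weight : PlaneTree (A × ℕ+) → ℕ
  | node d _ ts => d.2 + ∑ i, (ts i).weight

theorem Embeds.sum_vweight_eq {t : DecTree (A × ℕ+) V} {p : PlaneTree (A × ℕ+)} {u : V}
    (h : p.Embeds t u) : ∑ v ∈ t.desc u, (vweight t v : ℕ) = p.weight := by
  induction p generalizing u with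
  | node d m ts ih =>
    obtain ⟨rfl, σ, hσ⟩ := embeds_node h
    have := prod_children σ fun w => Multiplicative.ofAdd (∑ v ∈ t.desc w, (vweight t v : ℕ))
    rw [t.sum_desc, weight]
    refine congrArg _ (Eq.trans this (sum_congr rfl fun i _ => ih i (hσ i)))

variable [Fintype A] [DecidableEq A]

/-- The exponent of `G_b` in `G_a Q ^ k`, where `d = (a, k)`. -/
def exponent (s : A → K) (d : A × ℕ+) (b : A) : K :=
  if b = d.1 then 1 + s b * ((d.2 : ℕ) : K) else s b * ((d.2 : ℕ) : K)

/-- The product of the factors `ξ` of the vertices of a plane tree. -/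
def xiProd (s : A → K) : PlaneTree (A × ℕ+) → K
  | node d _ ts => (∏ b, fallingFactorial (exponent s d b)
      (univ.filter fun i => (ts i).dec.1 = b).card) * ∏ i, (ts i).xiProd s

omit [Fintype V] [DecidableEq V] [Algebra ℚ K] in
theorem xi_eq_prod (s : A → K) (t : DecTree (A × ℕ+) V) (v : V) :
    xi s t v = ∏ b, fallingFactorial (exponent s (t.dec v) b) (od t b v) := by
  rw [xi, ← mul_prod_erase univ _ (mem_univ (vtype t v))]
  congr 1
  · rw [exponent, if_pos (by rfl)]
    rfl
  · refine prod_congr rfl fun b hb => ?_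
    rw [exponent, if_neg (by exact (mem_erase.1 hb).1)]
    rfl

omit [Algebra ℚ K] in
theorem Embeds.prod_xi_eq (s : A → K) {t : DecTree (A × ℕ+) V} {p : PlaneTree (A × ℕ+)} {u : V}
    (h : p.Embeds t u) : ∏ v ∈ t.desc u, xi s t v = p.xiProd s := by
  induction p generalizing u with
  | node d m ts ih =>
    obtain ⟨rfl, σ, hσ⟩ := embeds_node h
    rw [t.prod_desc, xiProd, prod_children σ, xi_eq_prod]
    congr 1
    · refine prod_congr rfl fun b _ => congrArg _ ?_
      rw [od, ← Fintype.card_subtype, ← Nat.card_eq_fintype_card]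
      symm
      refine Nat.card_congr ((σ.subtypeEquiv fun i => ?_).trans
        (Equiv.subtypeSubtypeEquivSubtypeInter _ fun w => vtype t w = b))
      rw [vtype, (hσ i).dec_eq]
    · exact prod_congr rfl fun i _ => ih i (hσ i)

end Functionals

end PlaneTree

/-! ### Expansion of products of powers over words. -/

section Multinomial

variable {R P A : Type*} [CommRing R] [Fintype A] [DecidableEq A]

/-- A multinomial theorem for sums over words whose letters have types in `A`, weighted by a
function of the number of letters of each type. -/
theorem sum_words_eq_sum_piAntidiag (S : Finset P) (typ : P → A) (v : P → R) (w : A → ℕ → R)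
    (m : ℕ) :
    ∑ ts ∈ Fintype.piFinset fun _ : Fin m => S,
        (∏ b, w b (univ.filter fun i => typ (ts i) = b).card) * ∏ i, v (ts i) =
      ∑ r ∈ piAntidiag univ m, (Nat.multinomial univ r : R) *
        ∏ b, (w b (r b) * (∑ p ∈ S.filter fun p => typ p = b, v p) ^ r b) := by
  -- The variables record letter types. Expanding an m-th power by words and by multinomials, then
  -- applying the linear map that replaces each monomial by its weight, gives the two sides.
  let Ψ : MvPolynomial A R →ₗ[R] R :=
    (MvPolynomial.basisMonomials A R).constr R fun r => ∏ b, w b (r b)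
  have hΨ : ∀ r a, Ψ (MvPolynomial.monomial r a) = a * ∏ b, w b (r b) := by
    intro r a
    have h1 : MvPolynomial.monomial r a = a • MvPolynomial.basisMonomials A R r := by
      rw [MvPolynomial.coe_basisMonomials, MvPolynomial.smul_monomial, smul_eq_mul, mul_one]
    rw [h1, map_smul, Module.Basis.constr_basis, smul_eq_mul]
  have hsum : ∑ p ∈ S, MvPolynomial.monomial (Finsupp.single (typ p) 1) (v p) =
      ∑ b, MvPolynomial.monomial (Finsupp.single b 1) (∑ p ∈ S.filter fun p => typ p = b, v p) := by
    rw [← sum_fiberwise S typ]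
    refine sum_congr rfl fun b _ => ?_
    rw [map_sum]
    exact sum_congr rfl fun p hp => by rw [(mem_filter.1 hp).2]
  have lhs : (∑ p ∈ S, MvPolynomial.monomial (Finsupp.single (typ p) 1) (v p)) ^ m =
      ∑ ts ∈ Fintype.piFinset fun _ : Fin m => S,
        MvPolynomial.monomial (∑ i, Finsupp.single (typ (ts i)) 1) (∏ i, v (ts i)) := by
    rw [← Fin.prod_const, prod_univ_sum]
    exact sum_congr rfl fun ts _ => (MvPolynomial.monomial_sum_prod _ _ _).symm
  have key := congrArg Ψ (lhs.symm.trans (congrArg (· ^ m) hsum))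
  rw [sum_pow_eq_sum_piAntidiag, map_sum, map_sum] at key
  refine (sum_congr rfl fun ts _ => ?_).trans (key.trans (sum_congr rfl fun r _ => ?_))
  · rw [hΨ, mul_comm]
    congr 1
    refine prod_congr rfl fun b _ => ?_
    rw [Finsupp.finsetSum_apply, card_filter]
    simp only [Finsupp.single_apply]
  · simp_rw [MvPolynomial.monomial_pow]
    rw [← MvPolynomial.monomial_sum_prod, ← nsmul_eq_mul, map_nsmul, hΨ, nsmul_eq_mul,
      mul_comm (∏ _, _), prod_mul_distrib]
    congr 2
    refine prod_congr rfl fun b _ => ?_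
    rw [Finsupp.finsetSum_apply, sum_eq_single b]
    · simp
    · intro b' _ hb
      simp [hb]
    · simp

variable {K : Type*} [CommRing K] [Algebra ℚ K]

omit [DecidableEq A] in
-- This converts the single 1/m! attached to words into the factors 1/r_b! of the separate binomial
-- series.
theorem invFac_mul_multinomial (r : A → ℕ) :
    invFac K (∑ b, r b) * (Nat.multinomial univ r : K) = ∏ b, invFac K (r b) := by
  have h1 := factorial_mul_invFac (K := K) (∑ b, r b)
  have h2 : ∏ b, (((r b).factorial : K) * invFac K (r b)) = 1 :=
    prod_eq_one fun b _ => factorial_mul_invFac _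
  have h3 := congrArg (Nat.cast : ℕ → K) (Nat.multinomial_spec univ r)
  rw [prod_mul_distrib] at h2
  push_cast at h3
  linear_combination (∏ b, invFac K (r b)) * h1 -
    invFac K (∑ b, r b) * (Nat.multinomial univ r : K) * h2 +
    invFac K (∑ b, r b) * (∏ b, invFac K (r b)) * h3

open PlaneTree in
/-- Expansion of a product of powers of series `1 + H_b`, where `H_b` is a sum over the letters
of type `b`. -/
theorem coeff_prod_spow {N : ℕ} (S : Finset P) (typ : P → A) (v : P → PowerSeries K[X])
    (hv : ∀ p ∈ S, PowerSeries.constantCoeff (v p) = 0) (e : A → K) (G : A → PowerSeries K[X])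
    (hG : ∀ b, PowerSeries.constantCoeff (G b) = 1)
    (h : ∀ b, AgreeTo N (G b - 1) (∑ p ∈ S.filter fun p => typ p = b, v p)) :
    PowerSeries.coeff N (∏ b, spow (G b) (e b)) =
      ∑ m ∈ range (N + 1), ∑ ts ∈ Fintype.piFinset fun _ : Fin m => S,
        C (invFac K m * ∏ b, fallingFactorial (e b)
          (univ.filter fun i => typ (ts i) = b).card) *
        PowerSeries.coeff N (∏ i, v (ts i)) := by
  set H : A → PowerSeries K[X] := fun b => ∑ p ∈ S.filter fun p => typ p = b, v p with hH
  have hH0 : ∀ b, PowerSeries.X ∣ H b := fun b => dvd_sum fun p hp =>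
    PowerSeries.X_dvd_iff.2 (hv p (mem_filter.1 hp).1)
  let term (r : A → ℕ) : PowerSeries K[X] :=
    ∏ b, (PowerSeries.C (C (binCoeff (e b) (r b))) * H b ^ r b)
  have h1 : AgreeTo N (∏ b, spow (G b) (e b))
      (∏ b, ∑ r ∈ range (N + 1), PowerSeries.C (C (binCoeff (e b) r)) * H b ^ r) :=
    AgreeTo.prod _ fun b _ => (spow_agreeTo (hG b) (e b) N).trans
      (AgreeTo.sum _ fun r _ => AgreeTo.rfl.mul ((h b).pow r))
  rw [agreeTo_iff.1 h1 N le_rfl, prod_univ_sum, map_sum]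
  -- Each H_b is divisible by x, so exponent vectors of total size above N do not reach degree N;
  -- the others are grouped by total size m.
  have h2 : ∑ r ∈ Fintype.piFinset fun _ : A => range (N + 1), PowerSeries.coeff N (term r) =
      ∑ m ∈ range (N + 1), ∑ r ∈ piAntidiag univ m, PowerSeries.coeff N (term r) := by
    rw [← sum_biUnion]
    · symm
      refine sum_subset (fun r hr => ?_) fun r _ hr => ?_
      · obtain ⟨m, hm, hr⟩ := mem_biUnion.1 hr
        rw [mem_piAntidiag] at hr
        refine Fintype.mem_piFinset.2 fun b => mem_range.2 ?_
        have h5 : r b ≤ m := (single_le_sum (fun _ _ => Nat.zero_le _) (mem_univ b)).trans_eq hr.1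
        have := mem_range.1 hm
        omega
      · have hlt : N < ∑ b, r b := by
          by_contra hle
          exact hr (mem_biUnion.2 ⟨∑ b, r b, mem_range.2 (by omega),
            mem_piAntidiag.2 ⟨rfl, fun _ _ => mem_univ _⟩⟩)
        have hdvd : PowerSeries.X ^ (∑ b, r b) ∣ term r := by
          rw [← prod_pow_eq_pow_sum]
          exact prod_dvd_prod_of_dvd _ _ fun b _ => (pow_dvd_pow_of_dvd (hH0 b) _).mul_left _
        exact PowerSeries.X_pow_dvd_iff.1 hdvd N hlt
    · intro m _ m' _ hne
      rw [Function.onFun, disjoint_left]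
      intro r hr hr'
      exact hne ((mem_piAntidiag.1 hr).1.symm.trans (mem_piAntidiag.1 hr').1)
  refine h2.trans (sum_congr rfl fun m _ => ?_)
  have h3 := congrArg (fun f => PowerSeries.coeff N (PowerSeries.C (C (invFac K m)) * f))
    (sum_words_eq_sum_piAntidiag S typ v
      (fun b n => PowerSeries.C (C (fallingFactorial (e b) n))) m)
  rw [mul_sum, mul_sum, map_sum, map_sum] at h3
  refine (sum_congr rfl fun r hr => ?_).trans (h3.symm.trans (sum_congr rfl fun ts _ => ?_))
  · congr 1
    have hm := (mem_piAntidiag.1 hr).1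
    simp only [term, hH, prod_mul_distrib, ← map_prod]
    rw [← mul_assoc, ← mul_assoc]
    congr 1
    rw [← map_natCast (PowerSeries.C (R := K[X])), ← map_natCast (C (R := K)), ← map_mul, ← map_mul,
      ← map_mul, ← map_mul, ← hm, invFac_mul_multinomial, ← prod_mul_distrib]
    rfl
  · rw [← map_prod, ← map_prod, ← mul_assoc, ← map_mul, ← map_mul, PowerSeries.coeff_C_mul]

end Multinomial

namespace DecTree

/-! ### Isomorphism classes of finite trees. -/

section Classes

variable {D V W : Type*}

/-- Transport of a tree along a bijection of its vertices. -/
def relabel (t : DecTree D W) (e : W ≃ V) : DecTree D V where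
  root := e t.root
  parent x := e (t.parent (e.symm x))
  parent_root := by simp [t.parent_root]
  reaches_root x := by
    obtain ⟨n, hn⟩ := t.reaches_root (e.symm x)
    refine ⟨n, ?_⟩
    have : Function.Semiconj e t.parent fun x => e (t.parent (e.symm x)) := fun y => by simp
    rw [← hn, this.iterate_right n (e.symm x), e.apply_symm_apply]
  dec x := t.dec (e.symm x)

/-- A relabelled tree is isomorphic to the original one. -/
def relabelIso (t : DecTree D W) (e : W ≃ V) : Iso t (t.relabel e) :=
  ⟨⟨e, by
    intro x y
    rw [graph_adj_iff, graph_adj_iff]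
    simp [relabel]⟩, rfl, fun v => congrArg t.dec (e.symm_apply_apply v)⟩

/-- The isomorphism class of a finite decorated tree. -/
def toClass [Finite W] (t : DecTree D W) : TreeClass D :=
  Quotient.mk _ ⟨Nat.card W, t.relabel (Finite.equivFin W)⟩

theorem toClass_eq_iff [Finite W] (t : DecTree D W) (T : TreeClass D) :
    t.toClass = T ↔ Nonempty (Iso t T.rep) := by
  have h : t.toClass = T ↔ Nonempty (Iso (t.relabel (Finite.equivFin W)) T.rep) := by
    conv_lhs => rw [← Quotient.out_eq T]
    exact Quotient.eq
  rw [h]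
  exact ⟨fun ⟨f⟩ => ⟨(t.relabelIso _).trans f⟩, fun ⟨f⟩ => ⟨(t.relabelIso _).symm.trans f⟩⟩

end Classes

end DecTree

namespace PlaneTree

/-! ### Plane trees of bounded weight. -/

section Enumeration

variable {A : Type*}

theorem weight_pos (p : PlaneTree (A × ℕ+)) : 0 < p.weight := by
  cases p with
  | node d m ts => rw [weight]; exact Nat.add_pos_left d.2.pos _

/-- The root has weight at least 1, so branches have smaller weight; each branch has positive
weight, so their number is bounded too. -/
theorem exists_weight_le [Finite A] (n : ℕ) :
    ∃ S : Finset (PlaneTree (A × ℕ+)), ∀ p, p.weight ≤ n → p ∈ S := by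
  classical
  have := Fintype.ofFinite A
  induction n with
  | zero => exact ⟨∅, fun p hp => absurd p.weight_pos (by omega)⟩
  | succ n ih =>
    obtain ⟨S, hS⟩ := ih
    refine ⟨(((univ ×ˢ (range (n + 1)).image Nat.succPNat) ×ˢ range (n + 1)).sigma
      fun x => Fintype.piFinset fun _ : Fin x.2 => S).image fun x => node x.1.1 x.1.2 x.2, ?_⟩
    rintro ⟨d, m, ts⟩ hp
    rw [weight] at hp
    have hd := d.2.pos
    have hm : m ≤ ∑ i, (ts i).weight := by
      simpa using sum_le_sum fun i (_ : i ∈ univ) => Nat.succ_le_of_lt (ts i).weight_pos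
    refine mem_image.2 ⟨⟨(d, m), ts⟩, ?_, rfl⟩
    simp only [mem_sigma, mem_product, mem_univ, true_and, mem_image, mem_range,
      Fintype.mem_piFinset]
    refine ⟨⟨⟨d.2.natPred, ?_, PNat.succPNat_natPred _⟩, by omega⟩, fun i => hS _ ?_⟩
    · have := PNat.natPred_add_one d.2
      omega
    · have := single_le_sum (f := fun i => (ts i).weight) (fun _ _ => Nat.zero_le _) (mem_univ i)
      omega

variable [Finite A]

theorem finite_weight_le (n : ℕ) : {p : PlaneTree (A × ℕ+) | p.weight ≤ n}.Finite := by
  obtain ⟨S, hS⟩ := exists_weight_le (A := A) n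
  exact S.finite_toSet.subset hS

/-- The plane trees of weight at most `n`. -/
def upTo (A : Type*) [Finite A] (n : ℕ) : Finset (PlaneTree (A × ℕ+)) :=
  (finite_weight_le n).toFinset

theorem mem_upTo {n : ℕ} {p : PlaneTree (A × ℕ+)} : p ∈ upTo A n ↔ p.weight ≤ n := by
  simp [upTo]

open scoped Classical in
/-- The plane trees of weight `n` with root of type `a`. -/
def ofWeight (a : A) (n : ℕ) : Finset (PlaneTree (A × ℕ+)) :=
  (upTo A n).filter fun p => p.weight = n ∧ p.dec.1 = a

theorem mem_ofWeight {a : A} {n : ℕ} {p : PlaneTree (A × ℕ+)} :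
    p ∈ ofWeight a n ↔ p.weight = n ∧ p.dec.1 = a := by
  classical
  rw [ofWeight, mem_filter, mem_upTo]
  exact ⟨And.right, fun h => ⟨h.1.le, h⟩⟩

end Enumeration

/-! ### The tubing expansion solves the system. -/

section Terms

variable {K : Type*} [CommRing K] [Algebra ℚ K] {A : Type*} [Fintype A] [DecidableEq A]
  (s : A → K) (c : ℕ → A × ℕ+ → K)

/-- The contribution of a plane tree. -/
def term (p : PlaneTree (A × ℕ+)) : K[X] :=
  C (p.xiProd s * algebraMap ℚ K p.mass) * p.poly c

/-- Each of the three ingredients of a term is recursive at the root, and Λ is K-linear; the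
argument of Λ has the shape of a summand in `coeff_prod_spow`. -/
theorem term_node (d : A × ℕ+) (m : ℕ) (ts : Fin m → PlaneTree (A × ℕ+)) :
    (node d m ts).term s c = Lam (fun n => c n d)
      (C (invFac K m * ∏ b, fallingFactorial (exponent s d b)
        (univ.filter fun i => (ts i).dec.1 = b).card) * ∏ i, (ts i).term s c) := by
  simp only [term, xiProd, mass, poly, prod_mul_distrib, ← map_prod]
  rw [← mul_assoc, ← map_mul, DecTree.Lam_C_mul]
  congr 2
  rw [map_mul, map_prod, invFac]
  ring

omit [Fintype A] [DecidableEq A] in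
theorem embeds_rep_iff {p : PlaneTree (A × ℕ+)} {T : TreeClass (A × ℕ+)} :
    p.Embeds T.rep T.rep.root ↔ p.toDecTree.toClass = T := by
  rw [embeds_root_iff, DecTree.toClass_eq_iff]

omit [Fintype A] [DecidableEq A] in
theorem Embeds.weight_eq {V : Type*} [Fintype V] {t : DecTree (A × ℕ+) V}
    {p : PlaneTree (A × ℕ+)} (h : p.Embeds t t.root) : DysonSchwinger.weight t = p.weight := by
  classical
  rw [← h.sum_vweight_eq, DecTree.desc_root, DysonSchwinger.weight]

open scoped Classical in
/-- The contribution of a tree is the sum of the contributions of its plane embeddings. -/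
theorem coeff_treeTerm (T : TreeClass (A × ℕ+)) (n : ℕ) :
    PowerSeries.coeff n (treeTerm s c T.rep) =
      ∑ p ∈ (ofWeight (vtype T.rep T.rep.root) n).filter fun p => p.toDecTree.toClass = T,
        p.term s c := by
  rw [treeTerm, PowerSeries.coeff_monomial]
  split_ifs with hn
  · have hmem : ∀ p, p ∈ (ofWeight (vtype T.rep T.rep.root) n).filter
        (fun p => p.toDecTree.toClass = T) ↔ p.Embeds T.rep T.rep.root := by
      intro p
      rw [mem_filter, mem_ofWeight, ← embeds_rep_iff, and_iff_right_iff_imp]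
      intro h
      refine ⟨h.weight_eq.symm.trans hn.symm, ?_⟩
      rw [vtype, h.dec_eq]
    -- 1/|Aut| is distributed over the plane embeddings; the ξ-product and the tubing polynomial are
    -- the same for all of them.
    rw [← sum_mass T.rep _ hmem, map_sum, mul_sum, map_sum, sum_mul]
    refine sum_congr rfl fun p hp => ?_
    have h := (hmem p).1 hp
    rw [term, tubingSum_eq_subtreeSum, h.subtreeSum_eq, ← h.prod_xi_eq, DecTree.desc_root]
  · symm
    refine sum_eq_zero fun p hp => ?_
    rw [mem_filter, mem_ofWeight, ← embeds_rep_iff] at hp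
    exact absurd (hp.1.1.symm.trans hp.2.weight_eq.symm) hn

theorem locallyFinite_treeTerms (a : A) : LocallyFinite (treeTerms s c a) := by
  classical
  intro n
  refine Set.Finite.subset (((ofWeight a n).image fun p => p.toDecTree.toClass).finite_toSet.preimage
    (Subtype.val_injective.injOn)) fun (T : TreesOfType a) hT => ?_
  have hT : PowerSeries.coeff n (treeTerms s c a T) ≠ 0 := hT
  rw [treeTerms, coeff_treeTerm, T.2] at hT
  obtain ⟨p, hp, -⟩ := exists_ne_zero_of_sum_ne_zero hT
  exact mem_coe.2 (mem_image.2 ⟨p, mem_filter.1 hp⟩)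

theorem coeff_tubingExpansion (a : A) (n : ℕ) :
    PowerSeries.coeff n (tubingExpansion s c a) =
      PowerSeries.coeff n (1 : PowerSeries K[X]) + ∑ p ∈ ofWeight a n, p.term s c := by
  classical
  have htype : ∀ p : PlaneTree (A × ℕ+), vtype p.toDecTree.toClass.rep
      p.toDecTree.toClass.rep.root = p.dec.1 := fun p => by
    have h : p.Embeds p.toDecTree.toClass.rep p.toDecTree.toClass.rep.root :=
      embeds_rep_iff.2 rfl
    rw [vtype, h.dec_eq]
  rw [tubingExpansion, map_add, formalSum, PowerSeries.coeff_mk]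
  congr 1
  let I := (ofWeight a n).image fun p => p.toDecTree.toClass
  have hI : ∀ T ∈ I, vtype T.rep T.rep.root = a := by
    intro T hT
    obtain ⟨p, hp, rfl⟩ := mem_image.1 hT
    rw [htype, (mem_ofWeight.1 hp).2]
  let J : Finset (TreesOfType a) := I.subtype fun T : TreeClass (A × ℕ+) => vtype T.rep T.rep.root = a
  rw [finsum_eq_sum_of_support_subset (s := J)]
  · have h1 : ∀ T : TreesOfType a, PowerSeries.coeff n (treeTerms s c a T) =
        ∑ p ∈ (ofWeight a n).filter fun p => p.toDecTree.toClass = T.1, p.term s c := by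
      intro T
      rw [treeTerms, coeff_treeTerm, T.2]
    rw [sum_congr rfl fun T _ => h1 T]
    refine (sum_subtype_of_mem (fun T => ∑ p ∈ (ofWeight a n).filter
      fun p => p.toDecTree.toClass = T, p.term s c) hI).trans ?_
    exact sum_fiberwise_of_maps_to (fun p hp => mem_image_of_mem _ hp) _
  · intro T hT
    rw [Function.mem_support, treeTerms, coeff_treeTerm, T.2] at hT
    obtain ⟨p, hp, -⟩ := exists_ne_zero_of_sum_ne_zero hT
    exact mem_coe.2 (mem_subtype.2 (mem_image.2 ⟨p, mem_filter.1 hp⟩))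

theorem constantCoeff_tubingExpansion (a : A) :
    PowerSeries.constantCoeff (tubingExpansion s c a) = 1 := by
  rw [← PowerSeries.coeff_zero_eq_constantCoeff_apply, coeff_tubingExpansion,
    PowerSeries.coeff_zero_one, sum_eq_zero, add_zero]
  intro p hp
  exact absurd (mem_ofWeight.1 hp).1 p.weight_pos.ne'

/-- The monomial series attached to a plane tree. -/
def series (p : PlaneTree (A × ℕ+)) : PowerSeries K[X] :=
  PowerSeries.monomial p.weight (p.term s c)

theorem tubingExpansion_agreeTo (a : A) (N : ℕ) :
    AgreeTo N (tubingExpansion s c a - 1)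
      (∑ p ∈ (upTo A N).filter fun p => p.dec.1 = a, p.series s c) := by
  refine agreeTo_iff.2 fun n hn => ?_
  rw [map_sub, coeff_tubingExpansion, add_sub_cancel_left, map_sum]
  simp only [series, PowerSeries.coeff_monomial]
  rw [← sum_filter]
  refine sum_congr ?_ fun _ _ => rfl
  ext p
  rw [mem_ofWeight, mem_filter, mem_filter, mem_upTo]
  constructor
  · rintro ⟨rfl, h⟩; exact ⟨⟨hn, h⟩, rfl⟩
  · rintro ⟨⟨-, h⟩, rfl⟩; exact ⟨rfl, h⟩

theorem coeff_prod_series {ι : Type*} (I : Finset ι) (ts : ι → PlaneTree (A × ℕ+)) (N : ℕ) :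
    PowerSeries.coeff N (∏ i ∈ I, (ts i).series s c) =
      if N = ∑ i ∈ I, (ts i).weight then ∏ i ∈ I, (ts i).term s c else 0 := by
  simp only [series]
  rw [PowerSeries.prod_monomial, PowerSeries.coeff_monomial]

omit [DecidableEq A] in
-- A plane tree is a root of weight j + 1 with a word of m branches of total weight n - (j + 1).
-- Branches have positive weight, which bounds m by that total.
theorem sum_ofWeight {M : Type*} [AddCommMonoid M] (f : PlaneTree (A × ℕ+) → M) (a : A) (n : ℕ) :
    ∑ p ∈ ofWeight a n, f p = ∑ j ∈ range n, ∑ m ∈ range (n - (j + 1) + 1),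
      ∑ ts ∈ (Fintype.piFinset fun _ : Fin m => upTo A (n - (j + 1))).filter
        fun ts => n - (j + 1) = ∑ i, (ts i).weight, f (node (a, j.succPNat) m ts) := by
  simp_rw [sum_sigma']
  symm
  refine sum_nbij (fun x => node (a, x.1.succPNat) x.2.1 x.2.2) ?_ ?_ ?_ fun _ _ => rfl
  · rintro ⟨j, m, ts⟩ h
    simp only [mem_sigma, mem_range, mem_filter, mem_ofWeight, weight, dec,
      Nat.succPNat_coe] at h ⊢
    exact ⟨by omega, trivial⟩
  · rintro ⟨j, m, ts⟩ - ⟨j', m', ts'⟩ - h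
    simp only [node.injEq, Prod.mk.injEq, true_and] at h
    obtain ⟨h1, rfl, h3⟩ := h
    obtain rfl := Nat.succPNat_injective h1
    obtain rfl := eq_of_heq h3
    rfl
  · rintro ⟨⟨b, k⟩, m, ts⟩ h
    obtain ⟨hw, rfl⟩ := mem_ofWeight.1 h
    rw [weight] at hw
    have hk := PNat.natPred_add_one k
    have hm : m ≤ ∑ i, (ts i).weight := by
      simpa using sum_le_sum fun i (_ : i ∈ univ) => Nat.succ_le_of_lt (ts i).weight_pos
    dsimp only at hw
    refine ⟨⟨k.natPred, m, ts⟩, ?_, ?_⟩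
    · simp only [coe_sigma, Set.mem_sigma_iff, mem_coe, mem_range, mem_filter,
        Fintype.mem_piFinset, mem_upTo]
      refine ⟨by omega, by omega, fun i => ?_, by omega⟩
      have := single_le_sum (f := fun i => (ts i).weight) (fun _ _ => Nat.zero_le _) (mem_univ i)
      omega
    · dsimp only
      rw [PNat.succPNat_natPred]
      rfl

theorem isSolution_tubingExpansion : IsSolution s c fun a => tubingExpansion s c a := by
  refine ⟨constantCoeff_tubingExpansion s c, fun a => ?_⟩
  refine (equation_iff_coeff s c (fun a => tubingExpansion s c a) a).2 fun n => ?_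
  rw [coeff_tubingExpansion, sum_ofWeight]
  refine congrArg _ (sum_congr rfl fun j _ => ?_)
  rw [mul_Qser_pow s (constantCoeff_tubingExpansion s c)]
  have hexp : ∀ b, (if b = a then 1 + s b * ((j + 1 : ℕ) : K) else s b * ((j + 1 : ℕ) : K)) =
      exponent s (a, j.succPNat) b := fun b => rfl
  simp_rw [hexp]
  rw [coeff_prod_spow (upTo A (n - (j + 1))) (fun p => p.dec.1) (fun p => p.series s c) _ _ _
    (constantCoeff_tubingExpansion s c) fun b => tubingExpansion_agreeTo s c b _]
  · rw [← lamLin_apply, map_sum]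
    refine sum_congr rfl fun m _ => ?_
    -- The restriction on the total weight of the branches matches the vanishing of the other
    -- coefficients of a product of monomials.
    rw [map_sum, sum_filter]
    refine sum_congr rfl fun ts _ => ?_
    rw [coeff_prod_series, term_node, lamLin_apply]
    split_ifs
    · rfl
    · rw [mul_zero, ← lamLin_apply, map_zero]
  · intro p _
    rw [← PowerSeries.coeff_zero_eq_constantCoeff_apply, series, PowerSeries.coeff_monomial,
      if_neg p.weight_pos.ne]

end Terms

end PlaneTree

end DysonSchwinger

end

theorem mainTheorem3 {K : Type*} [CommRing K] [Algebra ℚ K]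
    {A : Type*} [Fintype A] [DecidableEq A]
    (s : A → K) (c : ℕ → A × ℕ+ → K) :
    (∀ a : A, DysonSchwinger.LocallyFinite (DysonSchwinger.treeTerms s c a)) ∧
    DysonSchwinger.IsSolution s c (fun a => DysonSchwinger.tubingExpansion s c a) ∧
    (∀ G : A → PowerSeries (Polynomial K), DysonSchwinger.IsSolution s c G →
      ∀ a : A, G a = DysonSchwinger.tubingExpansion s c a) :=
  ⟨DysonSchwinger.PlaneTree.locallyFinite_treeTerms s c,
    DysonSchwinger.PlaneTree.isSolution_tubingExpansion s c,
    fun _ hG => hG.unique (DysonSchwinger.PlaneTree.isSolution_tubingExpansion s c)⟩
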